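/- Fix a dyadic lattice $\mathcal D$ on $\mathbb R$, i.e. for some $a\in\mathbb R$, $r>0$, the intervals $[a+kr2^{-n},a+(k+1)r2^{-n})$ with $n,k\in\mathbb Z$. For $I\in\mathcal D$ let $\mathcal D(I)=\{J\in\mathcal D: J\subseteq I\}$, and let $J^-$, $J^+$ be the left and right halves of $J$. A weight is a locally integrable function $w$ on $\mathbb R$ that is positive almost everywhere; $\langle w\rangle_J=\frac1{|J|}\int_J w$, $\Delta_J w=\langle w\rangle_{J^-}-\langle w\rangle_{J^+}$, and $[w]_{A_2^d}=\sup_{J\in\mathcal D}\langle w\rangle_J\langle w^{-1}\rangle_J\in[1,\infty]$. For $\alpha\in\mathbb R$ and a weight $w$ with $[w]_{A_2^d}<\infty$ let $$c_J^{(\alpha)}(w)=|J|\,\langle w\rangle_J^\alpha\langle w^{-1}\rangle_J^\alpha\left[\frac{(\Delta_J w)^2}{\langle w\rangle_J^2}+\frac{(\Delta_J w^{-1})^2}{\langle w^{-1}\rangle_J^2}\right],\qquad \|\{c_J^{(\alpha)}(w)\}\|_{\mathcal C}=\sup_{I\in\mathcal D}\frac1{|I|}\sum_{J\in\mathcal D(I)}c_J^{(\alpha)}(w),$$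 and for $Q\ge1$ let $$K_\alpha(Q)=\sup_{w:\,[w]_{A_2^d}=Q}\|\{c_J^{(\alpha)}(w)\}\|_{\mathcal C},\qquad k_\alpha(Q)=\inf_{w:\,[w]_{A_2^d}=Q}\|\{c_J^{(\alpha)}(w)\}\|_{\mathcal C}.$$ Then for every $Q\ge1$ and $\alpha\in\mathbb R$: $$K_\alpha(Q)=\begin{cases}\dfrac{8(2\alpha+1)}{\alpha}Q^\alpha-\dfrac{32\alpha}{2\alpha-1}Q^{\alpha-1/2}+\dfrac{8}{\alpha(2\alpha-1)},&\alpha\in(0,\tfrac12)\cup(\tfrac12,1]\cup[\tfrac32,\infty);\\[2mm] 32Q^{1/2}-8\log Q-32,&\alpha=\tfrac12;\\[1mm] 8\log Q,&\alpha=0;\\[1mm] \dfrac8\alpha(Q^\alpha-1),&\alpha<0;\end{cases}$$ for $\alpha\in(1,\tfrac32)$, $$K_\alpha(Q)\le 8\cdot3^{2-2\alpha}(\sqrt Q-1)(8Q-\sqrt Q-1)^{2\alpha-2}(3\sqrt Q-1)^{3-2\alpha}=[K_1(Q)]^{3-2\alpha}[K_{3/2}(Q)]^{2\alpha-2};$$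 and $$k_\alpha(Q)=\begin{cases}\dfrac8\alpha(Q^\alpha-1),&\alpha\ge1;\\[2mm] 8\,(Q^\alpha-Q^{\alpha-1}),&\alpha<1.\end{cases}$$ -/

import Mathlib

open MeasureTheory
open scoped ENNReal

noncomputable section

namespace DyadicCarleson

/-- The `k`-th interval of generation `n` of the dyadic lattice on the line whose root
interval is `[a, a + r)`: a half-open interval of length `r * 2 ^ (-n)`. -/
def interval (a r : ℝ) (n k : ℤ) : Set ℝ :=
  Set.Ico (a + k * (r * 2 ^ (-n))) (a + (k + 1) * (r * 2 ^ (-n)))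

/-- The length `|J|` of a dyadic interval of generation `n`. -/
def len (r : ℝ) (n : ℤ) : ℝ := r * 2 ^ (-n)

/-- A weight: a locally integrable function on the line that is positive almost everywhere. -/
def IsWeight (w : ℝ → ℝ) : Prop :=
  LocallyIntegrable w volume ∧ ∀ᵐ x ∂(volume : Measure ℝ), 0 < w x

/-- The dyadic `A₂`-characteristic `sup_J ⟨w⟩_J ⟨w⁻¹⟩_J`, over all intervals of the lattice,
as an extended non-negative number. The averages are Lebesgue integrals, so that the
characteristic of a weight `w` is `∞` if `w⁻¹` fails to be integrable on some interval. -/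
def characteristic (a r : ℝ) (w : ℝ → ℝ) : ℝ≥0∞ :=
  ⨆ (n : ℤ) (k : ℤ),
    (⨍⁻ x in interval a r n k, ENNReal.ofReal (w x) ∂volume) *
      (⨍⁻ x in interval a r n k, ENNReal.ofReal ((w x)⁻¹) ∂volume)

/-- The average `⟨w⟩_J` over the dyadic interval `J` with indices `n`, `k`. -/
def avg (a r : ℝ) (w : ℝ → ℝ) (n k : ℤ) : ℝ :=
  ⨍ x in interval a r n k, w x ∂volume

/-- The difference `Δ_J w = ⟨w⟩_{J⁻} - ⟨w⟩_{J⁺}` of the averages over the left and right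
halves of `J`. -/
def delta (a r : ℝ) (w : ℝ → ℝ) (n k : ℤ) : ℝ :=
  avg a r w (n + 1) (2 * k) - avg a r w (n + 1) (2 * k + 1)

/-- The number `c_J^Φ(w) =
|J| Φ(⟨w⟩_J ⟨w⁻¹⟩_J) [(Δ_J w)² / ⟨w⟩_J² + (Δ_J w⁻¹)² / ⟨w⁻¹⟩_J²]`. -/
def coeff (a r : ℝ) (Φ : ℝ → ℝ) (w : ℝ → ℝ) (n k : ℤ) : ℝ :=
  len r n * Φ (avg a r w n k * avg a r w⁻¹ n k) *
    ((delta a r w n k) ^ 2 / (avg a r w n k) ^ 2 +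
      (delta a r w⁻¹ n k) ^ 2 / (avg a r w⁻¹ n k) ^ 2)

/-- The Carleson norm `sup_I |I|⁻¹ ∑_{J ∈ D(I)} c_J` of a non-negative family indexed by the
dyadic lattice, which is the least admissible constant and is `∞` if the family is not a
Carleson sequence. The dyadic subintervals of generation `j` of the interval `I` with indices
`n`, `k` are the intervals with indices `n + j` and `2 ^ j * k + i`, where `i < 2 ^ j`. -/
def carlesonNorm (r : ℝ) (c : ℤ → ℤ → ℝ) : ℝ≥0∞ :=
  ⨆ (n : ℤ) (k : ℤ), (ENNReal.ofReal (len r n))⁻¹ *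
    ∑' j : ℕ, ∑ i ∈ Finset.range (2 ^ j), ENNReal.ofReal (c (n + j) (2 ^ j * k + i))

/-- The best upper constant `K_Φ(Q)`: the supremum of the Carleson norms of `c^Φ(w)` over all
weights `w` whose dyadic `A₂`-characteristic is equal to `Q`. -/
def upperConst (a r : ℝ) (Φ : ℝ → ℝ) (Q : ℝ) : ℝ≥0∞ :=
  ⨆ (w : ℝ → ℝ) (_ : IsWeight w ∧ characteristic a r w = ENNReal.ofReal Q),
    carlesonNorm r (coeff a r Φ w)

/-- The best lower constant `k_Φ(Q)`: the infimum of the Carleson norms of `c^Φ(w)` over all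
weights `w` whose dyadic `A₂`-characteristic is equal to `Q`. -/
def lowerConst (a r : ℝ) (Φ : ℝ → ℝ) (Q : ℝ) : ℝ≥0∞ :=
  ⨅ (w : ℝ → ℝ) (_ : IsWeight w ∧ characteristic a r w = ENNReal.ofReal Q),
    carlesonNorm r (coeff a r Φ w)

/-- `K_α(Q)`, the constant `K_Φ(Q)` for `Φ(t) = t ^ α`. -/
def upperPow (a r α Q : ℝ) : ℝ≥0∞ := upperConst a r (fun t => t ^ α) Q

/-- `k_α(Q)`, the constant `k_Φ(Q)` for `Φ(t) = t ^ α`. -/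
def lowerPow (a r α Q : ℝ) : ℝ≥0∞ := lowerConst a r (fun t => t ^ α) Q

end DyadicCarleson

end

noncomputable section

namespace DyadicCarleson

/-! Put t = ⟨w⟩_J ⟨w⁻¹⟩_J, which lies in [1, Q]. If p and q are the relative jumps of w and w⁻¹ at
J, the halves of J carry the products t(1+p)(1+q) and t(1-p)(1-q), and J contributes
|J|·4Φ(t)(p²+q²). Only the scalar t matters, so the constants are values of a one-dimensional
control problem. A nonnegative function satisfying `IsSuper` telescopes over generations to an upper
bound (`upperConst_le`). A function satisfying `IsSub` and vanishing at 1 telescopes to a lower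
bound, its remainder tending to 0 because t → 1 almost everywhere by Lebesgue differentiation
(`le_lowerConst`).

Two moves are extremal. With q = -p both halves drop to t(1-p²); with q = p the variable √t jumps
symmetrically by ±p√t. Many small moves of the first kind, from Q down to 1, collect 8∫₁^Q Φ(t)
dt/t; this is the upper constant for α ≤ 0 and the lower one for α ≥ 1. A single such move from Q to
1 collects 8(1-1/Q)Φ(Q), the lower constant for α < 1. The matching Bellman functions are elementary
(Bernoulli's inequality, log x ≤ x - 1).

For the upper constant with α > 0 one lets √t diffuse by moves of the second kind and reflects it at
Y = √Q by moves of the first kind. With β = 2α - 2 this gives F'' = -16 y^β, F(1) = 0, F'(Y) = 16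
Y^(β+1), which is `Profile`. A small-step random walk shows that F(Y) is a lower bound for every β
(`Profile.le_upperConst`). For the upper bound let A, B be the square roots of the two factors
multiplying t, m = (A+B)/2 and d = |A-B|/2. Then 2F(y) - F(yA) - F(yB) splits into twice the drop
from y to ym, bounded by the slope of F, and a symmetric second difference about ym, bounded by
midpoint convexity of u^β (`Profile.main_inequality`). Convexity is lost for 0 < β < 1, that is 1 <
α < 3/2; there t^α is dominated by a combination of t and t^(3/2), which gives the geometric mean of
the two endpoint constants. -/

/-! ### Dyadic intervals and averages. -/

lemma len_pos {r : ℝ} (hr : 0 < r) (n : ℤ) : 0 < len r n := by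
  unfold len; positivity

lemma len_succ (r : ℝ) (n : ℤ) : len r n = 2 * len r (n + 1) := by
  unfold len
  rw [neg_add, zpow_add₀ two_ne_zero]
  norm_num
  ring

lemma interval_eq_Ico (a r : ℝ) (n k : ℤ) :
    interval a r n k = Set.Ico (a + k * len r n) (a + (k + 1) * len r n) := rfl

lemma measurableSet_interval (a r : ℝ) (n k : ℤ) : MeasurableSet (interval a r n k) :=
  measurableSet_Ico

lemma volume_interval (a r : ℝ) (n k : ℤ) :
    volume (interval a r n k) = ENNReal.ofReal (len r n) := by
  rw [interval_eq_Ico, Real.volume_Ico]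
  congr 1
  ring

lemma volume_real_interval (a : ℝ) {r : ℝ} (hr : 0 < r) (n k : ℤ) :
    volume.real (interval a r n k) = len r n := by
  rw [measureReal_def, volume_interval, ENNReal.toReal_ofReal (len_pos hr n).le]

lemma interval_union (a : ℝ) {r : ℝ} (hr : 0 < r) (n k : ℤ) :
    interval a r (n + 1) (2 * k) ∪ interval a r (n + 1) (2 * k + 1) = interval a r n k := by
  have h := len_pos hr (n + 1)
  simp only [interval_eq_Ico]
  rw [len_succ r n]
  push_cast
  have e1 : a + (2 * (k : ℝ) + 1) * len r (n + 1) = a + 2 * k * len r (n + 1) + len r (n + 1) := by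
    ring
  have e2 : a + (2 * (k : ℝ) + 1 + 1) * len r (n + 1)
      = a + 2 * k * len r (n + 1) + len r (n + 1) + len r (n + 1) := by
    ring
  rw [Set.Ico_union_Ico_eq_Ico (by linarith) (by linarith)]
  congr 1 <;> ring

lemma interval_disjoint (a r : ℝ) (n k : ℤ) :
    Disjoint (interval a r (n + 1) (2 * k)) (interval a r (n + 1) (2 * k + 1)) := by
  simp only [interval_eq_Ico]
  rw [Set.Ico_disjoint_Ico]
  push_cast
  exact (min_le_left _ _).trans (le_max_right _ _)

lemma mem_interval_iff (a : ℝ) {r : ℝ} (hr : 0 < r) (n k : ℤ) (x : ℝ) :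
    x ∈ interval a r n k ↔ ⌊(x - a) / len r n⌋ = k := by
  have h := len_pos hr n
  rw [interval_eq_Ico, Int.floor_eq_iff, Set.mem_Ico, le_div_iff₀ h, div_lt_iff₀ h]
  constructor <;> rintro ⟨h1, h2⟩ <;> constructor <;> linarith

lemma floor_succ_div_two (a : ℝ) {r : ℝ} (hr : 0 < r) (n : ℤ) (x : ℝ) :
    ⌊(x - a) / len r (n + 1)⌋ / 2 = ⌊(x - a) / len r n⌋ := by
  have h := len_pos hr (n + 1)
  have e : (x - a) / len r (n + 1) / ((2 : ℕ) : ℝ) = (x - a) / len r n := by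
    rw [len_succ r n, div_div, mul_comm]; norm_num
  have := Int.floor_div_natCast ((x - a) / len r (n + 1)) 2
  rw [e] at this
  rw [this]; norm_num

lemma avg_eq (a : ℝ) {r : ℝ} (hr : 0 < r) (w : ℝ → ℝ) (n k : ℤ) :
    avg a r w n k = (len r n)⁻¹ * ∫ x in interval a r n k, w x := by
  rw [avg, setAverage_eq, volume_real_interval a hr, smul_eq_mul]

lemma avg_split (a : ℝ) {r : ℝ} (hr : 0 < r) {w : ℝ → ℝ} {n k : ℤ}
    (h : IntegrableOn w (interval a r n k)) :
    avg a r w n k = (avg a r w (n + 1) (2 * k) + avg a r w (n + 1) (2 * k + 1)) / 2 := by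
  have hl := len_pos hr (n + 1)
  rw [← interval_union a hr] at h
  simp only [avg_eq a hr]
  rw [← interval_union a hr, setIntegral_union (interval_disjoint a r n k)
    (measurableSet_interval _ _ _ _) h.left_of_union h.right_of_union, len_succ r n]
  field_simp

/-- A function that is integrable over every interval of the lattice. -/
def DyadicIntegrable (a r : ℝ) (w : ℝ → ℝ) : Prop :=
  ∀ n k, IntegrableOn w (interval a r n k)

lemma ofReal_avg (a : ℝ) {r : ℝ} {w : ℝ → ℝ} (hw : DyadicIntegrable a r w)
    (h0 : ∀ᵐ x ∂(volume : Measure ℝ), 0 < w x) (n k : ℤ) :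
    ENNReal.ofReal (avg a r w n k) =
      ⨍⁻ x in interval a r n k, ENNReal.ofReal (w x) ∂volume := by
  rw [avg, ofReal_setAverage (hw n k) (ae_restrict_of_ae (h0.mono fun x hx => hx.le)),
    setLAverage_eq]

lemma LocallyIntegrable.dyadicIntegrable (a r : ℝ) {w : ℝ → ℝ}
    (hw : LocallyIntegrable w volume) : DyadicIntegrable a r w := fun n k =>
  (hw.integrableOn_isCompact isCompact_Icc).mono_set (Set.Ico_subset_Icc_self :
    interval a r n k ⊆ Set.Icc _ _)

lemma avg_pos (a : ℝ) {r : ℝ} (hr : 0 < r) {w : ℝ → ℝ} (hw : DyadicIntegrable a r w)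
    (h0 : ∀ᵐ x ∂(volume : Measure ℝ), 0 < w x) (n k : ℤ) : 0 < avg a r w n k := by
  rw [avg_eq a hr]
  refine mul_pos (inv_pos.2 (len_pos hr n)) ?_
  rw [setIntegral_pos_iff_support_of_nonneg_ae
    (ae_restrict_of_ae (h0.mono fun x hx => hx.le)) (hw n k)]
  have : volume (interval a r n k) ≤ volume (Function.support w ∩ interval a r n k) := by
    refine measure_mono_ae ?_
    filter_upwards [h0] with x hx hxi
    exact ⟨hx.ne', hxi⟩
  refine lt_of_lt_of_le ?_ this
  rw [volume_interval]
  exact ENNReal.ofReal_pos.2 (len_pos hr n)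

/-- Integrate (w - c)²/w ≥ 0, where c is the average of w. -/
lemma one_le_avg_mul_avg_inv (a : ℝ) {r : ℝ} (hr : 0 < r) {w : ℝ → ℝ}
    (hw : DyadicIntegrable a r w) (hw' : DyadicIntegrable a r w⁻¹)
    (h0 : ∀ᵐ x ∂(volume : Measure ℝ), 0 < w x) (n k : ℤ) :
    1 ≤ avg a r w n k * avg a r w⁻¹ n k := by
  have hx := avg_pos a hr hw h0 n k
  set c := avg a r w n k with hc
  have hl := len_pos hr n
  have key : ∫ x in interval a r n k, (2 * c) ≤ ∫ x in interval a r n k, (w x + c ^ 2 * w⁻¹ x) := by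
    refine integral_mono_ae ?_ ((hw n k).add ((hw' n k).const_mul _)) (ae_restrict_of_ae ?_)
    · refine integrableOn_const ?_
      rw [volume_interval]; exact ENNReal.ofReal_ne_top
    · filter_upwards [h0] with x hx0
      simp only [Pi.inv_apply]
      have : w x + c ^ 2 * (w x)⁻¹ - 2 * c = (w x - c) ^ 2 * (w x)⁻¹ := by
        field_simp; ring
      have h2 : 0 ≤ (w x - c) ^ 2 * (w x)⁻¹ := by positivity
      linarith
  rw [integral_add (hw n k) ((hw' n k).const_mul _), setIntegral_const,
    volume_real_interval a hr, smul_eq_mul] at key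
  have e0 : ∫ x in interval a r n k, c ^ 2 * w⁻¹ x = c ^ 2 * ∫ x in interval a r n k, w⁻¹ x :=
    integral_const_mul _ _
  have e1 : ∫ x in interval a r n k, w x = len r n * c := by
    rw [hc, avg_eq a hr]; field_simp
  have e2 : ∫ x in interval a r n k, w⁻¹ x = len r n * avg a r w⁻¹ n k := by
    rw [avg_eq a hr]; field_simp
  rw [e0, e1, e2] at key
  have : c * 1 ≤ c * (c * avg a r w⁻¹ n k) := by
    have : len r n * (c * 1) ≤ len r n * (c * (c * avg a r w⁻¹ n k)) := by linarith
    exact le_of_mul_le_mul_left this hl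
  exact le_of_mul_le_mul_left this hx

lemma characteristic_eq (a : ℝ) {r : ℝ} (hr : 0 < r) {w : ℝ → ℝ} (hw : DyadicIntegrable a r w)
    (hw' : DyadicIntegrable a r w⁻¹) (h0 : ∀ᵐ x ∂(volume : Measure ℝ), 0 < w x) :
    characteristic a r w =
      ⨆ (n : ℤ) (k : ℤ), ENNReal.ofReal (avg a r w n k * avg a r w⁻¹ n k) := by
  refine iSup_congr fun n => iSup_congr fun k => ?_
  have h1 : ∀ᵐ x ∂(volume : Measure ℝ), 0 < w⁻¹ x := h0.mono fun x hx => inv_pos.2 hx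
  rw [ENNReal.ofReal_mul (avg_pos a hr hw h0 n k).le, ofReal_avg a hw h0, ofReal_avg a hw' h1]
  rfl

/-- The product of the two averages is finite and the average of w is positive, so the other factor
cannot be infinite. -/
lemma dyadicIntegrable_inv (a : ℝ) {r : ℝ} (hr : 0 < r) {w : ℝ → ℝ} (hw : IsWeight w)
    (hc : characteristic a r w ≠ ∞) : DyadicIntegrable a r w⁻¹ := by
  intro n k
  have hi := LocallyIntegrable.dyadicIntegrable a r hw.1
  have h1 : (⨍⁻ x in interval a r n k, ENNReal.ofReal (w x) ∂volume) *
      (⨍⁻ x in interval a r n k, ENNReal.ofReal ((w x)⁻¹) ∂volume) ≠ ∞ :=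
    ne_top_of_le_ne_top hc (le_iSup₂_of_le n k le_rfl)
  rw [← ofReal_avg a hi hw.2] at h1
  have h2 : (⨍⁻ x in interval a r n k, ENNReal.ofReal ((w x)⁻¹) ∂volume) ≠ ∞ := by
    intro h
    rw [h, ENNReal.mul_top (ENNReal.ofReal_pos.2 (avg_pos a hr hi hw.2 n k)).ne'] at h1
    exact h1 rfl
  rw [setLAverage_eq, volume_interval] at h2
  have h3 : (∫⁻ x in interval a r n k, ENNReal.ofReal ((w x)⁻¹) ∂volume) ≠ ∞ := by
    intro h
    rw [h, ENNReal.top_div_of_ne_top ENNReal.ofReal_ne_top] at h2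
    exact h2 rfl
  have hm : AEStronglyMeasurable w⁻¹ (volume.restrict (interval a r n k)) :=
    (hi n k).aestronglyMeasurable.aemeasurable.inv.aestronglyMeasurable
  refine ⟨hm, ?_⟩
  have h4 : ∀ᵐ x ∂(volume : Measure ℝ), 0 ≤ w⁻¹ x := hw.2.mono fun x hx => (inv_pos.2 hx).le
  rw [hasFiniteIntegral_iff_ofReal (ae_restrict_of_ae h4)]
  exact lt_top_iff_ne_top.2 h3

/-! ### Relative jumps of a weight. -/

/-- The relative half-difference of the averages over the two halves of an interval. -/
def jump (a r : ℝ) (w : ℝ → ℝ) (n k : ℤ) : ℝ := delta a r w n k / (2 * avg a r w n k)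

lemma avg_left (a : ℝ) {r : ℝ} (hr : 0 < r) {w : ℝ → ℝ} {n k : ℤ}
    (h : IntegrableOn w (interval a r n k)) (hp : avg a r w n k ≠ 0) :
    avg a r w (n + 1) (2 * k) = avg a r w n k * (1 + jump a r w n k) := by
  have := avg_split a hr h
  unfold jump
  field_simp
  unfold delta
  linarith

lemma avg_right (a : ℝ) {r : ℝ} (hr : 0 < r) {w : ℝ → ℝ} {n k : ℤ}
    (h : IntegrableOn w (interval a r n k)) (hp : avg a r w n k ≠ 0) :
    avg a r w (n + 1) (2 * k + 1) = avg a r w n k * (1 - jump a r w n k) := by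
  have := avg_split a hr h
  unfold jump
  field_simp
  unfold delta
  linarith

lemma coeff_eq_jump (a r : ℝ) (Φ : ℝ → ℝ) {w : ℝ → ℝ} {n k : ℤ}
    (hp : avg a r w n k ≠ 0) (hp' : avg a r w⁻¹ n k ≠ 0) :
    coeff a r Φ w n k = len r n * (4 * Φ (avg a r w n k * avg a r w⁻¹ n k) *
      ((jump a r w n k) ^ 2 + (jump a r w⁻¹ n k) ^ 2)) := by
  unfold coeff jump
  field_simp
  ring

/-! ### Sums over generations and the Carleson norm. -/

/-- The sum of a family over the dyadic subintervals of generation `j` of an interval. -/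
def genSum (c : ℤ → ℤ → ℝ) (n k : ℤ) (j : ℕ) : ℝ :=
  ∑ i ∈ Finset.range (2 ^ j), c (n + j) (2 ^ j * k + i)

lemma sum_range_two_mul (f : ℕ → ℝ) (m : ℕ) :
    ∑ i ∈ Finset.range (2 * m), f i = ∑ i ∈ Finset.range m, (f (2 * i) + f (2 * i + 1)) := by
  induction m with
  | zero => simp
  | succ m ih =>
    rw [Finset.sum_range_succ, ← ih, show 2 * (m + 1) = 2 * m + 1 + 1 by ring,
      Finset.sum_range_succ, Finset.sum_range_succ]
    ring

lemma genSum_zero (c : ℤ → ℤ → ℝ) (n k : ℤ) : genSum c n k 0 = c n k := by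
  simp [genSum]

/-- Groups the intervals by their parents, which serves the telescoping; `genSum_succ'` groups them
by the half of the top interval that contains them, which serves induction from the top. -/
lemma genSum_succ (c : ℤ → ℤ → ℝ) (n k : ℤ) (j : ℕ) :
    genSum c n k (j + 1) =
      genSum (fun m l => c (m + 1) (2 * l) + c (m + 1) (2 * l + 1)) n k j := by
  unfold genSum
  rw [pow_succ, mul_comm, sum_range_two_mul]
  refine Finset.sum_congr rfl fun i _ => ?_
  push_cast
  congr 2 <;> ring

lemma genSum_succ' (c : ℤ → ℤ → ℝ) (n k : ℤ) (j : ℕ) :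
    genSum c n k (j + 1) = genSum c (n + 1) (2 * k) j + genSum c (n + 1) (2 * k + 1) j := by
  unfold genSum
  rw [pow_succ, mul_two, Finset.sum_range_add]
  congr 1 <;> refine Finset.sum_congr rfl fun i _ => ?_ <;> push_cast <;> congr 1 <;> ring

lemma genSum_mono {c d : ℤ → ℤ → ℝ} {n : ℤ} (h : ∀ m, n ≤ m → ∀ k, c m k ≤ d m k) (k : ℤ) (j : ℕ) :
    genSum c n k j ≤ genSum d n k j :=
  Finset.sum_le_sum fun _ _ => h _ (by omega) _

lemma genSum_add (c d : ℤ → ℤ → ℝ) (n k : ℤ) (j : ℕ) :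
    genSum (fun m l => c m l + d m l) n k j = genSum c n k j + genSum d n k j :=
  Finset.sum_add_distrib

/-- Telescoping: the remainder of generation N is replaced by its contribution plus the remainder of
generation N + 1. `sum_genSum_le` is the same with the inequality reversed. -/
lemma le_sum_genSum {v c : ℤ → ℤ → ℝ} {n : ℤ}
    (h : ∀ m, n ≤ m → ∀ k, v m k ≤ c m k + (v (m + 1) (2 * k) + v (m + 1) (2 * k + 1)))
    (k : ℤ) (N : ℕ) :
    v n k ≤ ∑ j ∈ Finset.range N, genSum c n k j + genSum v n k N := by
  induction N with
  | zero => simp [genSum_zero]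
  | succ N ih =>
    rw [Finset.sum_range_succ, genSum_succ, add_assoc, ← genSum_add]
    exact ih.trans (add_le_add_right (genSum_mono h k N) _)

lemma sum_genSum_le {v c : ℤ → ℤ → ℝ} {n : ℤ}
    (h : ∀ m, n ≤ m → ∀ k, c m k + (v (m + 1) (2 * k) + v (m + 1) (2 * k + 1)) ≤ v m k)
    (k : ℤ) (N : ℕ) :
    ∑ j ∈ Finset.range N, genSum c n k j + genSum v n k N ≤ v n k := by
  induction N with
  | zero => simp [genSum_zero]
  | succ N ih =>
    rw [Finset.sum_range_succ, genSum_succ, add_assoc, ← genSum_add]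
    exact le_trans (add_le_add_right (genSum_mono h k N) _) ih

lemma sum_ofReal_eq {c : ℤ → ℤ → ℝ} (hc : ∀ n k, 0 ≤ c n k) (n k : ℤ) (j : ℕ) :
    ∑ i ∈ Finset.range (2 ^ j), ENNReal.ofReal (c (n + j) (2 ^ j * k + i)) =
      ENNReal.ofReal (genSum c n k j) :=
  (ENNReal.ofReal_sum_of_nonneg fun _ _ => hc _ _).symm

lemma genSum_nonneg {c : ℤ → ℤ → ℝ} (hc : ∀ n k, 0 ≤ c n k) (n k : ℤ) (j : ℕ) :
    0 ≤ genSum c n k j := Finset.sum_nonneg fun _ _ => hc _ _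

lemma inv_mul_ofReal_mul {l : ℝ} (hl : 0 < l) (K : ℝ) :
    (ENNReal.ofReal l)⁻¹ * ENNReal.ofReal (l * K) = ENNReal.ofReal K := by
  rw [ENNReal.ofReal_mul hl.le, ← mul_assoc,
    ENNReal.inv_mul_cancel (ENNReal.ofReal_pos.2 hl).ne' ENNReal.ofReal_ne_top, one_mul]

lemma carlesonNorm_le {r : ℝ} (hr : 0 < r) {c : ℤ → ℤ → ℝ} (hc : ∀ n k, 0 ≤ c n k) {K : ℝ}
    (h : ∀ n k (N : ℕ), ∑ j ∈ Finset.range N, genSum c n k j ≤ len r n * K) :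
    carlesonNorm r c ≤ ENNReal.ofReal K := by
  refine iSup₂_le fun n k => ?_
  rw [← inv_mul_ofReal_mul (len_pos hr n) K]
  gcongr
  refine ENNReal.tsum_le_of_sum_range_le fun N => ?_
  simp only [sum_ofReal_eq hc]
  rw [← ENNReal.ofReal_sum_of_nonneg fun j _ => genSum_nonneg hc n k j]
  exact ENNReal.ofReal_le_ofReal (h n k N)

lemma le_carlesonNorm {r : ℝ} (hr : 0 < r) {c : ℤ → ℤ → ℝ} (hc : ∀ n k, 0 ≤ c n k) {K : ℝ}
    {n k : ℤ} {N : ℕ} (h : len r n * K ≤ ∑ j ∈ Finset.range N, genSum c n k j) :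
    ENNReal.ofReal K ≤ carlesonNorm r c := by
  refine le_trans ?_ (le_iSup₂ (f := fun n k => (ENNReal.ofReal (len r n))⁻¹ *
    ∑' j : ℕ, ∑ i ∈ Finset.range (2 ^ j), ENNReal.ofReal (c (n + j) (2 ^ j * k + i))) n k)
  rw [← inv_mul_ofReal_mul (len_pos hr n) K]
  gcongr
  refine le_trans ?_ (ENNReal.sum_le_tsum (Finset.range N))
  simp only [sum_ofReal_eq hc]
  rw [← ENNReal.ofReal_sum_of_nonneg fun j _ => genSum_nonneg hc n k j]
  exact ENNReal.ofReal_le_ofReal h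

/-! ### Weights of finite characteristic. -/

/-- What is used of a weight whose characteristic is the real number `Q`. -/
structure IsA2 (a r : ℝ) (w : ℝ → ℝ) (Q : ℝ) : Prop where
  int : DyadicIntegrable a r w
  int' : DyadicIntegrable a r w⁻¹
  pos : ∀ᵐ x ∂(volume : Measure ℝ), 0 < w x
  le : ∀ n k, avg a r w n k * avg a r w⁻¹ n k ≤ Q
  exists_lt : ∀ q, 1 ≤ q → q < Q → ∃ n k, q < avg a r w n k * avg a r w⁻¹ n k

lemma isA2_of_characteristic (a : ℝ) {r : ℝ} (hr : 0 < r) {w : ℝ → ℝ} {Q : ℝ} (hQ : 1 ≤ Q)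
    (hw : IsWeight w) (h : characteristic a r w = ENNReal.ofReal Q) : IsA2 a r w Q := by
  have hi := LocallyIntegrable.dyadicIntegrable a r hw.1
  have hi' := dyadicIntegrable_inv a hr hw (by rw [h]; exact ENNReal.ofReal_ne_top)
  rw [characteristic_eq a hr hi hi' hw.2] at h
  refine ⟨hi, hi', hw.2, fun n k => ?_, fun q hq hqQ => ?_⟩
  · rw [← ENNReal.ofReal_le_ofReal_iff (by linarith), ← h]
    exact le_iSup₂_of_le n k le_rfl
  · have : ENNReal.ofReal q < ENNReal.ofReal Q := (ENNReal.ofReal_lt_ofReal_iff (by linarith)).2 hqQ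
    rw [← h] at this
    obtain ⟨n, hn⟩ := lt_iSup_iff.1 this
    obtain ⟨k, hk⟩ := lt_iSup_iff.1 hn
    exact ⟨n, k, (ENNReal.ofReal_lt_ofReal_iff_of_nonneg (by linarith)).1 hk⟩

namespace IsA2

variable {a r : ℝ} {w : ℝ → ℝ} {Q : ℝ}

lemma pos_inv (h : IsA2 a r w Q) : ∀ᵐ x ∂(volume : Measure ℝ), 0 < w⁻¹ x :=
  h.pos.mono fun _ hx => inv_pos.2 hx

lemma one_le (h : IsA2 a r w Q) (hr : 0 < r) (n k : ℤ) :
    1 ≤ avg a r w n k * avg a r w⁻¹ n k :=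
  one_le_avg_mul_avg_inv a hr h.int h.int' h.pos n k

lemma avg_pos (h : IsA2 a r w Q) (hr : 0 < r) (n k : ℤ) : 0 < avg a r w n k :=
  DyadicCarleson.avg_pos a hr h.int h.pos n k

lemma avg_inv_pos (h : IsA2 a r w Q) (hr : 0 < r) (n k : ℤ) : 0 < avg a r w⁻¹ n k :=
  DyadicCarleson.avg_pos a hr h.int' h.pos_inv n k

lemma coeff_nonneg (h : IsA2 a r w Q) (hr : 0 < r) {Φ : ℝ → ℝ} (hΦ : ∀ t, 1 ≤ t → 0 ≤ Φ t)
    (n k : ℤ) : 0 ≤ coeff a r Φ w n k := by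
  have := hΦ _ (h.one_le hr n k)
  have := len_pos hr n
  unfold coeff
  positivity

/-- The data of one dyadic splitting, in terms of `t = ⟨w⟩_J ⟨w⁻¹⟩_J` and of the relative
jumps. -/
lemma split (h : IsA2 a r w Q) (hr : 0 < r) (Φ : ℝ → ℝ) (n k : ℤ) :
    ∃ t p q : ℝ, t = avg a r w n k * avg a r w⁻¹ n k ∧
      avg a r w (n + 1) (2 * k) * avg a r w⁻¹ (n + 1) (2 * k) = t * ((1 + p) * (1 + q)) ∧
      avg a r w (n + 1) (2 * k + 1) * avg a r w⁻¹ (n + 1) (2 * k + 1)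
        = t * ((1 - p) * (1 - q)) ∧
      |p| < 1 ∧ |q| < 1 ∧ coeff a r Φ w n k = len r n * (4 * Φ t * (p ^ 2 + q ^ 2)) := by
  have h1 := h.avg_pos hr n k
  have h2 := h.avg_inv_pos hr n k
  have hl := avg_left a hr (h.int n k) h1.ne'
  have hrr := avg_right a hr (h.int n k) h1.ne'
  have hl' := avg_left a hr (h.int' n k) h2.ne'
  have hrr' := avg_right a hr (h.int' n k) h2.ne'
  have bd : ∀ x y : ℝ, 0 < x → 0 < x * (1 + y) → 0 < x * (1 - y) → |y| < 1 := by
    intro x y hx h1 h2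
    have := pos_of_mul_pos_right h1 hx.le
    have := pos_of_mul_pos_right h2 hx.le
    rw [abs_lt]; constructor <;> linarith
  refine ⟨_, jump a r w n k, jump a r w⁻¹ n k, rfl, ?_, ?_, ?_, ?_,
    coeff_eq_jump a r Φ h1.ne' h2.ne'⟩
  · rw [hl, hl']; ring
  · rw [hrr, hrr']; ring
  · exact bd _ _ h1 (hl ▸ h.avg_pos hr _ _) (hrr ▸ h.avg_pos hr _ _)
  · exact bd _ _ h2 (hl' ▸ h.avg_inv_pos hr _ _) (hrr' ▸ h.avg_inv_pos hr _ _)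

end IsA2

/-! ### Bellman inequalities and induction on scales. -/

/-- The main inequality satisfied by an upper Bellman function. -/
def IsSuper (Q : ℝ) (Φ f : ℝ → ℝ) : Prop :=
  ∀ t p q : ℝ, t ∈ Set.Icc 1 Q → |p| < 1 → |q| < 1 → t * ((1 + p) * (1 + q)) ∈ Set.Icc 1 Q →
    t * ((1 - p) * (1 - q)) ∈ Set.Icc 1 Q →
    4 * Φ t * (p ^ 2 + q ^ 2) + (f (t * ((1 + p) * (1 + q))) + f (t * ((1 - p) * (1 - q)))) / 2
      ≤ f t

/-- The main inequality satisfied by a lower Bellman function. -/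
def IsSub (Q : ℝ) (Φ f : ℝ → ℝ) : Prop :=
  ∀ t p q : ℝ, t ∈ Set.Icc 1 Q → |p| < 1 → |q| < 1 → t * ((1 + p) * (1 + q)) ∈ Set.Icc 1 Q →
    t * ((1 - p) * (1 - q)) ∈ Set.Icc 1 Q →
    f t ≤
      4 * Φ t * (p ^ 2 + q ^ 2) + (f (t * ((1 + p) * (1 + q))) + f (t * ((1 - p) * (1 - q)))) / 2

/-- Telescoping bounds every partial sum over D(I) by |I| f(t_I) minus a remainder, which is
discarded because f ≥ 0. -/
theorem upperConst_le (a : ℝ) {r : ℝ} (hr : 0 < r) {Q : ℝ} (hQ : 1 ≤ Q) {Φ f : ℝ → ℝ} {K : ℝ}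
    (hΦ : ∀ t, 1 ≤ t → 0 ≤ Φ t) (hf : IsSuper Q Φ f) (hf0 : ∀ t ∈ Set.Icc 1 Q, 0 ≤ f t)
    (hfK : ∀ t ∈ Set.Icc 1 Q, f t ≤ K) : upperConst a r Φ Q ≤ ENNReal.ofReal K := by
  refine iSup₂_le fun w hw => ?_
  have h := isA2_of_characteristic a hr hQ hw.1 hw.2
  have hmem : ∀ n k, avg a r w n k * avg a r w⁻¹ n k ∈ Set.Icc 1 Q := fun n k =>
    ⟨h.one_le hr n k, h.le n k⟩
  refine carlesonNorm_le hr (h.coeff_nonneg hr hΦ) fun n k N => ?_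
  have key := sum_genSum_le (n := n) (c := coeff a r Φ w)
    (v := fun m l => len r m * f (avg a r w m l * avg a r w⁻¹ m l)) (fun m _ l => ?_) k N
  · have h1 : 0 ≤ genSum (fun m l => len r m * f (avg a r w m l * avg a r w⁻¹ m l)) n k N :=
      genSum_nonneg (fun m l => mul_nonneg (len_pos hr m).le (hf0 _ (hmem m l))) n k N
    have h2 := mul_le_mul_of_nonneg_left (hfK _ (hmem n k)) (len_pos hr n).le
    linarith
  · obtain ⟨t, p, q, ht, hl, hrt, hp, hq, hc⟩ := h.split hr Φ m l
    have h1 := hmem (m + 1) (2 * l)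
    have h2 := hmem (m + 1) (2 * l + 1)
    have h0 := hmem m l
    simp only [hl, hrt, hc, ← ht] at h0 h1 h2 ⊢
    have := mul_le_mul_of_nonneg_left (hf t p q h0 hp hq h1 h2) (len_pos hr m).le
    rw [len_succ r m] at this ⊢
    linarith

/-- Writes the remainder of the telescoping as an integral over a fixed interval, so that dominated
convergence applies. -/
lemma integral_step (a : ℝ) {r : ℝ} (hr : 0 < r) (v : ℤ → ℤ → ℝ) (j : ℕ) :
    ∀ n k : ℤ, IntegrableOn (fun x => v (n + j) ⌊(x - a) / len r (n + j)⌋) (interval a r n k) ∧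
      ∫ x in interval a r n k, v (n + j) ⌊(x - a) / len r (n + j)⌋ =
        genSum (fun m l => len r m * v m l) n k j := by
  induction j with
  | zero =>
    intro n k
    have e : Set.EqOn (fun x => v (n + (0 : ℕ)) ⌊(x - a) / len r (n + (0 : ℕ))⌋)
        (fun _ => v n k) (interval a r n k) := by
      intro x hx
      rw [mem_interval_iff a hr] at hx
      simp [hx]
    constructor
    · refine IntegrableOn.congr_fun ?_ e.symm (measurableSet_interval _ _ _ _)
      refine integrableOn_const ?_
      rw [volume_interval]; exact ENNReal.ofReal_ne_top
    · rw [setIntegral_congr_fun (measurableSet_interval _ _ _ _) e, setIntegral_const,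
        volume_real_interval a hr, genSum_zero, smul_eq_mul]
  | succ j ih =>
    intro n k
    have e : n + ((j + 1 : ℕ) : ℤ) = n + 1 + j := by push_cast; ring
    rw [e, ← interval_union a hr]
    obtain ⟨i1, s1⟩ := ih (n + 1) (2 * k)
    obtain ⟨i2, s2⟩ := ih (n + 1) (2 * k + 1)
    refine ⟨i1.union i2, ?_⟩
    rw [setIntegral_union (interval_disjoint a r n k) (measurableSet_interval _ _ _ _) i1 i2,
      s1, s2, genSum_succ']

lemma tendsto_len (r : ℝ) (n : ℤ) :
    Filter.Tendsto (fun j : ℕ => len r (n + j)) Filter.atTop (nhds 0) := by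
  have : (fun j : ℕ => len r (n + j)) = fun j : ℕ => len r n * (1 / 2) ^ j := by
    funext j
    unfold len
    rw [neg_add, zpow_add₀ two_ne_zero]
    simp [zpow_neg, mul_assoc]
  rw [this]
  simpa using (tendsto_pow_atTop_nhds_zero_of_lt_one (by norm_num : (0:ℝ) ≤ 1 / 2)
    (by norm_num)).const_mul (len r n)

lemma interval_subset (a : ℝ) {r : ℝ} (hr : 0 < r) {n k : ℤ} {x : ℝ}
    (hx : x ∈ interval a r n k) (j : ℕ) :
    interval a r (n + j) ⌊(x - a) / len r (n + j)⌋ ⊆ interval a r n k := by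
  intro y hy
  rw [mem_interval_iff a hr] at hx hy ⊢
  rw [← hx]
  clear hx
  induction j with
  | zero => simpa using hy
  | succ j ih =>
    refine ih ?_
    have e : n + ((j + 1 : ℕ) : ℤ) = n + j + 1 := by push_cast; ring
    rw [e] at hy
    rw [← floor_succ_div_two a hr, ← floor_succ_div_two a hr _ x, hy]

lemma ae_tendsto_avg (a : ℝ) {r : ℝ} (hr : 0 < r) {w : ℝ → ℝ} (hw : DyadicIntegrable a r w)
    (n k : ℤ) :
    ∀ᵐ x ∂(volume.restrict (interval a r n k)),
      Filter.Tendsto (fun j : ℕ => avg a r w (n + j) ⌊(x - a) / len r (n + j)⌋) Filter.atTop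
        (nhds (w x)) := by
  have hint : LocallyIntegrable ((interval a r n k).indicator w) volume :=
    ((integrable_indicator_iff (measurableSet_interval a r n k)).2 (hw n k)).locallyIntegrable
  have hae := IsUnifLocDoublingMeasure.ae_tendsto_average (μ := volume) hint 1
  rw [ae_restrict_iff' (measurableSet_interval a r n k)]
  filter_upwards [hae] with x hx hxi
  set m : ℕ → ℤ := fun j => ⌊(x - a) / len r (n + j)⌋ with hm
  -- Up to an endpoint the dyadic interval around x is the closed ball about its midpoint. It
  -- contains x without being centred there, which the differentiation theorem permits with dilation
  -- factor 1.
  have hball : ∀ j : ℕ, Metric.closedBall (a + (m j + 1 / 2) * len r (n + j)) (len r (n + j) / 2) =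
      Set.Icc (a + m j * len r (n + j)) (a + (m j + 1) * len r (n + j)) := by
    intro j
    rw [Real.closedBall_eq_Icc]
    congr 1 <;> ring
  have h := @hx ℕ Filter.atTop (fun j => a + (m j + 1 / 2) * len r (n + j))
    (fun j => len r (n + j) / 2) ?_ ?_
  · rw [Set.indicator_of_mem hxi] at h
    refine h.congr fun j => ?_
    rw [hball, avg, setAverage_congr (Ico_ae_eq_Icc (μ := volume)).symm]
    refine setAverage_congr_fun measurableSet_Ico (Filter.Eventually.of_forall fun y hy => ?_)
    exact Set.indicator_of_mem (interval_subset a hr hxi j hy) w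
  · refine tendsto_nhdsWithin_iff.2 ⟨?_, Filter.Eventually.of_forall fun j =>
      half_pos (len_pos hr _)⟩
    simpa using (tendsto_len r n).div_const 2
  · refine Filter.Eventually.of_forall fun j => ?_
    rw [one_mul, hball]
    exact Set.Ico_subset_Icc_self ((mem_interval_iff a hr (n + j) (m j) x).2 rfl)

/-- Almost everywhere the two averages tend to w(x) and w(x)⁻¹, so their product tends to 1, where f
vanishes. -/
lemma IsA2.tendsto_genSum {a r : ℝ} {w : ℝ → ℝ} {Q : ℝ} (h : IsA2 a r w Q) (hr : 0 < r)
    {f : ℝ → ℝ} (hf1 : f 1 = 0) (hfc : ContinuousAt f 1) {C : ℝ}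
    (hfC : ∀ t ∈ Set.Icc 1 Q, |f t| ≤ C) (n k : ℤ) :
    Filter.Tendsto (fun N : ℕ =>
      genSum (fun m l => len r m * f (avg a r w m l * avg a r w⁻¹ m l)) n k N)
      Filter.atTop (nhds 0) := by
  set v : ℤ → ℤ → ℝ := fun m l => f (avg a r w m l * avg a r w⁻¹ m l) with hv
  have hs := fun N : ℕ => integral_step a hr v N n k
  have key : Filter.Tendsto
      (fun N : ℕ => ∫ x in interval a r n k, v (n + N) ⌊(x - a) / len r (n + N)⌋)
      Filter.atTop (nhds (∫ x in interval a r n k, (0 : ℝ))) := by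
    refine tendsto_integral_of_dominated_convergence (fun _ => C)
      (fun N => (hs N).1.aestronglyMeasurable) ?_ ?_ ?_
    · refine integrableOn_const ?_
      rw [volume_interval]; exact ENNReal.ofReal_ne_top
    · exact fun N => Filter.Eventually.of_forall fun x =>
        hfC _ ⟨h.one_le hr _ _, h.le _ _⟩
    · filter_upwards [ae_tendsto_avg a hr h.int n k, ae_tendsto_avg a hr h.int' n k,
        ae_restrict_of_ae h.pos] with x h1 h2 h3
      have h4 := h1.mul h2
      rw [Pi.inv_apply, mul_inv_cancel₀ h3.ne'] at h4
      have h5 := hfc.tendsto.comp h4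
      rwa [hf1] at h5
  rw [integral_zero] at key
  exact key.congr fun N => (hs N).2

theorem le_lowerConst (a : ℝ) {r : ℝ} (hr : 0 < r) {Q : ℝ} (hQ : 1 ≤ Q) {Φ f : ℝ → ℝ}
    (hΦ : ∀ t, 1 ≤ t → 0 ≤ Φ t) (hf : IsSub Q Φ f) (hf1 : f 1 = 0)
    (hfc : ∀ t, 1 ≤ t → ContinuousAt f t) (hfm : MonotoneOn f (Set.Icc 1 Q)) :
    ENNReal.ofReal (f Q) ≤ lowerConst a r Φ Q := by
  refine le_iInf₂ fun w hw => ?_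
  have h := isA2_of_characteristic a hr hQ hw.1 hw.2
  have hmem : ∀ n k, avg a r w n k * avg a r w⁻¹ n k ∈ Set.Icc 1 Q := fun n k =>
    ⟨h.one_le hr n k, h.le n k⟩
  have hf0 : ∀ t ∈ Set.Icc 1 Q, 0 ≤ f t := fun t ht => by
    rw [← hf1]; exact hfm ⟨le_rfl, hQ⟩ ht ht.1
  have hfC : ∀ t ∈ Set.Icc 1 Q, |f t| ≤ f Q := fun t ht => by
    rw [abs_of_nonneg (hf0 t ht)]; exact hfm ht ⟨hQ, le_rfl⟩ ht.2
  have step : ∀ n k, ENNReal.ofReal (f (avg a r w n k * avg a r w⁻¹ n k)) ≤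
      carlesonNorm r (coeff a r Φ w) := by
    intro n k
    have hl := len_pos hr n
    set v : ℤ → ℤ → ℝ := fun m l => len r m * f (avg a r w m l * avg a r w⁻¹ m l) with hv
    have ht := h.tendsto_genSum hr hf1 (hfc 1 le_rfl) hfC n k
    have ht' : Filter.Tendsto (fun N : ℕ => ENNReal.ofReal
        (f (avg a r w n k * avg a r w⁻¹ n k) - (len r n)⁻¹ * genSum v n k N)) Filter.atTop
        (nhds (ENNReal.ofReal (f (avg a r w n k * avg a r w⁻¹ n k)))) := by
      refine (ENNReal.continuous_ofReal.tendsto _).comp ?_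
      simpa using (ht.const_mul (len r n)⁻¹).const_sub (f (avg a r w n k * avg a r w⁻¹ n k))
    refine le_of_tendsto ht' (Filter.Eventually.of_forall fun N => ?_)
    refine le_carlesonNorm hr (h.coeff_nonneg hr hΦ) (n := n) (k := k) (N := N) ?_
    have key := le_sum_genSum (n := n) (c := coeff a r Φ w) (v := v) (fun m _ l => ?_) k N
    · have e : len r n * (f (avg a r w n k * avg a r w⁻¹ n k) - (len r n)⁻¹ * genSum v n k N) =
          v n k - genSum v n k N := by
        rw [mul_sub, mul_inv_cancel_left₀ hl.ne']
      linarith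
    · obtain ⟨t, p, q, ht, hl, hrt, hp, hq, hc⟩ := h.split hr Φ m l
      have h1 := hmem (m + 1) (2 * l)
      have h2 := hmem (m + 1) (2 * l + 1)
      have h0 := hmem m l
      simp only [hv, hl, hrt, hc, ← ht] at h0 h1 h2 ⊢
      have := mul_le_mul_of_nonneg_left (hf t p q h0 hp hq h1 h2) (len_pos hr m).le
      rw [len_succ r m] at this ⊢
      linarith
  rcases hQ.eq_or_lt with rfl | hQ1
  · simp [hf1]
  -- The characteristic need not be attained, so Q is approached by values q < Q, each exceeded on
  -- some interval; monotonicity and continuity of f then give f(Q).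
  have ht : Filter.Tendsto (fun q => ENNReal.ofReal (f q)) (nhdsWithin Q (Set.Iio Q))
      (nhds (ENNReal.ofReal (f Q))) :=
    (ENNReal.continuous_ofReal.tendsto _).comp ((hfc Q hQ).tendsto.mono_left nhdsWithin_le_nhds)
  refine le_of_tendsto ht ?_
  filter_upwards [Ioo_mem_nhdsLT hQ1] with q hq
  obtain ⟨n, k, hnk⟩ := h.exists_lt q hq.1.le hq.2
  exact (ENNReal.ofReal_le_ofReal (hfm ⟨hq.1.le, hq.2.le⟩ (hmem n k) hnk.le)).trans (step n k)

/-! ### Step weights built from a splitting scheme. -/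

/-- A family in which every entry is the mean of its two children is determined on coarser
generations by generation M; j counts the generations between n and M. -/
lemma avg_step (a : ℝ) {r : ℝ} (hr : 0 < r) {X : ℤ → ℤ → ℝ} {M : ℤ} {g : ℝ → ℝ}
    (hg : ∀ x, g x = X M ⌊(x - a) / len r M⌋)
    (hX : ∀ n k, X n k = (X (n + 1) (2 * k) + X (n + 1) (2 * k + 1)) / 2) (j : ℕ) :
    ∀ n k, n + j = M → IntegrableOn g (interval a r n k) ∧ avg a r g n k = X n k := by
  induction j with
  | zero =>
    intro n k hn
    have hn' : n = M := by simpa using hn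
    subst hn'
    have e : Set.EqOn g (fun _ => X n k) (interval a r n k) := by
      intro x hx
      rw [mem_interval_iff a hr] at hx
      simp [hg, hx]
    have hv : volume (interval a r n k) ≠ ∞ := by
      rw [volume_interval]; exact ENNReal.ofReal_ne_top
    refine ⟨(integrableOn_const hv).congr_fun e.symm (measurableSet_interval _ _ _ _), ?_⟩
    rw [avg_eq a hr, setIntegral_congr_fun (measurableSet_interval _ _ _ _) e, setIntegral_const,
      volume_real_interval a hr, smul_eq_mul, inv_mul_cancel_left₀ (len_pos hr n).ne']
  | succ j ih =>
    intro n k hn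
    have hn' : n + 1 + (j : ℤ) = M := by rw [← hn]; push_cast; ring
    obtain ⟨i1, s1⟩ := ih (n + 1) (2 * k) hn'
    obtain ⟨i2, s2⟩ := ih (n + 1) (2 * k + 1) hn'
    have hi : IntegrableOn g (interval a r n k) := by
      rw [← interval_union a hr]; exact i1.union i2
    exact ⟨hi, by rw [avg_split a hr hi, s1, s2, hX n k]⟩

/-- A recipe for a step weight: a point whose product of coordinates is `τ i` is split, at time
`n`, by the relative jumps `p n i` and `q n i` into two points with products `τ (up n i)` and
`τ (dn n i)`. -/
structure Scheme where
  τ : ℕ → ℝ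
  p : ℕ → ℕ → ℝ
  q : ℕ → ℕ → ℝ
  up : ℕ → ℕ → ℕ
  dn : ℕ → ℕ → ℕ
  one_le : ∀ i, 1 ≤ τ i
  abs_p : ∀ n i, |p n i| < 1
  τ_up : ∀ n i, τ (up n i) = τ i * ((1 + p n i) * (1 + q n i))
  τ_dn : ∀ n i, τ (dn n i) = τ i * ((1 - p n i) * (1 - q n i))
  p_eq : ∀ n i, τ i = 1 → p n i = 0
  q_eq : ∀ n i, τ i = 1 → q n i = 0

namespace Scheme

variable (S : Scheme)

/-- The index of the point attached to the `k`-th interval of generation `n`. -/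
def idx (s : ℕ) : ℕ → ℤ → ℕ
  | 0, _ => s
  | n + 1, k => if k % 2 = 0 then S.up n (idx s n (k / 2)) else S.dn n (idx s n (k / 2))

/-- The first coordinate of the point attached to the `k`-th interval of generation `n`. -/
def val (s : ℕ) : ℕ → ℤ → ℝ
  | 0, _ => 1
  | n + 1, k => if k % 2 = 0 then val s n (k / 2) * (1 + S.p n (S.idx s n (k / 2)))
      else val s n (k / 2) * (1 - S.p n (S.idx s n (k / 2)))

variable (s : ℕ)

lemma idx_left (n : ℕ) (k : ℤ) : S.idx s (n + 1) (2 * k) = S.up n (S.idx s n k) := by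
  have h2 : 2 * k / 2 = k := by omega
  simp [idx, h2]

lemma idx_right (n : ℕ) (k : ℤ) : S.idx s (n + 1) (2 * k + 1) = S.dn n (S.idx s n k) := by
  have h1 : (2 * k + 1) % 2 ≠ 0 := by omega
  have h2 : (2 * k + 1) / 2 = k := by omega
  rw [idx, if_neg h1, h2]

lemma val_left (n : ℕ) (k : ℤ) :
    S.val s (n + 1) (2 * k) = S.val s n k * (1 + S.p n (S.idx s n k)) := by
  have h2 : 2 * k / 2 = k := by omega
  simp [val, h2]

lemma val_right (n : ℕ) (k : ℤ) :
    S.val s (n + 1) (2 * k + 1) = S.val s n k * (1 - S.p n (S.idx s n k)) := by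
  have h1 : (2 * k + 1) % 2 ≠ 0 := by omega
  have h2 : (2 * k + 1) / 2 = k := by omega
  rw [val, if_neg h1, h2]

lemma val_pos (n : ℕ) (k : ℤ) : 0 < S.val s n k := by
  induction n generalizing k with
  | zero => simp [val]
  | succ n ih =>
    have := abs_lt.1 (S.abs_p n (S.idx s n (k / 2)))
    rw [val]
    split_ifs
    · exact mul_pos (ih _) (by linarith)
    · exact mul_pos (ih _) (by linarith)

lemma val_le (n : ℕ) (k : ℤ) : S.val s n k ≤ 2 ^ n := by
  induction n generalizing k with
  | zero => simp [val]
  | succ n ih =>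
    have := abs_lt.1 (S.abs_p n (S.idx s n (k / 2)))
    have := ih (k / 2)
    have := S.val_pos s n (k / 2)
    rw [val, pow_succ]
    split_ifs
    · nlinarith
    · nlinarith

/-- The step weight at resolution `M`. -/
def weight (a r : ℝ) (M : ℕ) (x : ℝ) : ℝ := S.val s M ⌊(x - a) / len r M⌋

lemma isWeight_weight (a r : ℝ) (M : ℕ) : IsWeight (S.weight s a r M) := by
  have hm : Measurable (S.weight s a r M) := by
    unfold weight
    refine (measurable_from_top (f := S.val s M)).comp (Int.measurable_floor.comp ?_)
    fun_prop
  refine ⟨?_, Filter.Eventually.of_forall fun x => S.val_pos s _ _⟩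
  refine (locallyIntegrable_const ((2 : ℝ) ^ M)).mono hm.aestronglyMeasurable
    (Filter.Eventually.of_forall fun x => ?_)
  rw [weight, Real.norm_of_nonneg (S.val_pos s _ _).le, Real.norm_of_nonneg (by positivity)]
  exact S.val_le s _ _

variable {s}

/-- Product 1 is absorbing, since both jumps vanish there. Hence the weight is the same at every
resolution beyond M. -/
lemma τ_idx_of_le {M : ℕ} (hM : ∀ k, S.τ (S.idx s M k) = 1) {n : ℕ} (hn : M ≤ n) (k : ℤ) :
    S.τ (S.idx s n k) = 1 := by
  induction n, hn using Nat.le_induction generalizing k with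
  | base => exact hM k
  | succ n _ ih =>
    have h := ih (k / 2)
    rw [idx]
    split_ifs
    · rw [S.τ_up, S.p_eq n _ h, S.q_eq n _ h, h]; norm_num
    · rw [S.τ_dn, S.p_eq n _ h, S.q_eq n _ h, h]; norm_num

lemma weight_eq_of_le (a : ℝ) {r : ℝ} (hr : 0 < r) {M : ℕ} (hM : ∀ k, S.τ (S.idx s M k) = 1)
    {n : ℕ} (hn : M ≤ n) (x : ℝ) : S.weight s a r M x = S.val s n ⌊(x - a) / len r n⌋ := by
  induction n, hn using Nat.le_induction with
  | base => rfl
  | succ n h ih =>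
    have h1 := S.τ_idx_of_le hM h ⌊(x - a) / len r n⌋
    rw [ih, val]
    push_cast
    rw [floor_succ_div_two a hr, S.p_eq n _ h1]
    simp

/-- The second coordinate of the point attached to the `k`-th interval of generation `n`. -/
def val' (s : ℕ) (n : ℕ) (k : ℤ) : ℝ := S.τ (S.idx s n k) / S.val s n k

lemma val'_left (n : ℕ) (k : ℤ) :
    S.val' s (n + 1) (2 * k) = S.val' s n k * (1 + S.q n (S.idx s n k)) := by
  have := abs_lt.1 (S.abs_p n (S.idx s n k))
  have h1 : 1 + S.p n (S.idx s n k) ≠ 0 := by linarith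
  have := (S.val_pos s n k).ne'
  rw [val', idx_left, val_left, S.τ_up, val']
  field_simp

lemma val'_right (n : ℕ) (k : ℤ) :
    S.val' s (n + 1) (2 * k + 1) = S.val' s n k * (1 - S.q n (S.idx s n k)) := by
  have := abs_lt.1 (S.abs_p n (S.idx s n k))
  have h1 : 1 - S.p n (S.idx s n k) ≠ 0 := by linarith
  have := (S.val_pos s n k).ne'
  rw [val', idx_right, val_right, S.τ_dn, val']
  field_simp

/-- Generations n < 0 are treated as generation 0: the weight repeats one pattern on every interval
of generation 0, so coarser averages are constant and coarser jumps vanish. -/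
lemma exists_toNat (n : ℤ) : (n.toNat = 0 ∧ (n + 1).toNat = 0) ∨ (n + 1).toNat = n.toNat + 1 := by
  omega

lemma avg_weight (a : ℝ) {r : ℝ} (hr : 0 < r) {M : ℕ} (hM : ∀ k, S.τ (S.idx s M k) = 1)
    (n k : ℤ) : avg a r (S.weight s a r M) n k = S.val s n.toNat k := by
  obtain ⟨m, hm, j, hj⟩ : ∃ m : ℕ, M ≤ m ∧ ∃ j : ℕ, n + j = m :=
    ⟨max M n.toNat, le_max_left _ _, ((max M n.toNat : ℕ) - n).toNat, by omega⟩
  refine (avg_step a hr (X := fun n k => S.val s n.toNat k) (M := m)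
    (fun x => ?_) (fun n k => ?_) j n k hj).2
  · exact S.weight_eq_of_le a hr hM hm x
  · rcases exists_toNat n with ⟨h1, h2⟩ | h
    · simp [h1, h2, val]
    · rw [h, val_left, val_right]; ring

lemma avg_inv_weight (a : ℝ) {r : ℝ} (hr : 0 < r) {M : ℕ} (hM : ∀ k, S.τ (S.idx s M k) = 1)
    (n k : ℤ) : IntegrableOn (S.weight s a r M)⁻¹ (interval a r n k) ∧
      avg a r (S.weight s a r M)⁻¹ n k = S.val' s n.toNat k := by
  obtain ⟨m, hm, j, hj⟩ : ∃ m : ℕ, M ≤ m ∧ ∃ j : ℕ, n + j = m :=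
    ⟨max M n.toNat, le_max_left _ _, ((max M n.toNat : ℕ) - n).toNat, by omega⟩
  refine avg_step a hr (X := fun n k => S.val' s n.toNat k) (M := m)
    (fun x => ?_) (fun n k => ?_) j n k hj
  · rw [Pi.inv_apply, S.weight_eq_of_le a hr hM hm x]
    simp only [Int.toNat_natCast, val', S.τ_idx_of_le hM hm, one_div]
  · rcases exists_toNat n with ⟨h1, h2⟩ | h
    · simp [h1, h2, val', val, idx]
    · rw [h, val'_left, val'_right]; ring

lemma characteristic_weight (a : ℝ) {r : ℝ} (hr : 0 < r) {M : ℕ}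
    (hM : ∀ k, S.τ (S.idx s M k) = 1) (hs : ∀ i, S.τ i ≤ S.τ s) :
    characteristic a r (S.weight s a r M) = ENNReal.ofReal (S.τ s) := by
  have hw := S.isWeight_weight s a r M
  rw [characteristic_eq a hr (LocallyIntegrable.dyadicIntegrable a r hw.1)
    (fun n k => (S.avg_inv_weight a hr hM n k).1) hw.2]
  have e : ∀ n k, avg a r (S.weight s a r M) n k * avg a r (S.weight s a r M)⁻¹ n k =
      S.τ (S.idx s n.toNat k) := by
    intro n k
    have := (S.val_pos s n.toNat k).ne'
    rw [S.avg_weight a hr hM, (S.avg_inv_weight a hr hM n k).2, val']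
    field_simp
  simp only [e]
  refine le_antisymm (iSup₂_le fun n k => ENNReal.ofReal_le_ofReal (hs _)) ?_
  exact le_iSup₂_of_le 0 0 le_rfl

/-- The contribution of a split, relative to the length of the interval. -/
def gain (Φ : ℝ → ℝ) (n i : ℕ) : ℝ := 4 * Φ (S.τ i) * ((S.p n i) ^ 2 + (S.q n i) ^ 2)

lemma coeff_weight (a : ℝ) {r : ℝ} (hr : 0 < r) {M : ℕ} (hM : ∀ k, S.τ (S.idx s M k) = 1)
    (Φ : ℝ → ℝ) (n : ℕ) (k : ℤ) :
    coeff a r Φ (S.weight s a r M) n k = len r n * S.gain Φ n (S.idx s n k) := by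
  have h1 := (S.val_pos s n k).ne'
  have h2 : S.val' s n k ≠ 0 :=
    (div_pos (lt_of_lt_of_le one_pos (S.one_le _)) (S.val_pos s n k)).ne'
  have ht : S.val s n k * S.val' s n k = S.τ (S.idx s n k) := by
    rw [val']; field_simp
  have e : ((n : ℤ) + 1).toNat = n + 1 := by omega
  unfold coeff delta gain
  simp only [S.avg_weight a hr hM, (S.avg_inv_weight a hr hM _ _).2, e, Int.toNat_natCast, ht,
    val_left, val_right, val'_left, val'_right]
  field_simp
  ring

lemma coeff_weight_of_neg (a : ℝ) {r : ℝ} (hr : 0 < r) {M : ℕ}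
    (hM : ∀ k, S.τ (S.idx s M k) = 1) (Φ : ℝ → ℝ) {n : ℤ} (hn : n < 0) (k : ℤ) :
    coeff a r Φ (S.weight s a r M) n k = 0 := by
  have e1 : n.toNat = 0 := by omega
  have e2 : (n + 1).toNat = 0 := by omega
  unfold coeff delta
  simp [S.avg_weight a hr hM, (S.avg_inv_weight a hr hM _ _).2, e1, e2, val, val', idx]

lemma coeff_weight_nonneg (a : ℝ) {r : ℝ} (hr : 0 < r) {M : ℕ}
    (hM : ∀ k, S.τ (S.idx s M k) = 1) {Φ : ℝ → ℝ} (hΦ : ∀ t, 1 ≤ t → 0 ≤ Φ t) (n k : ℤ) :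
    0 ≤ coeff a r Φ (S.weight s a r M) n k := by
  rcases lt_or_ge n 0 with h | h
  · rw [S.coeff_weight_of_neg a hr hM Φ h]
  · lift n to ℕ using h
    rw [S.coeff_weight a hr hM]
    have := hΦ _ (S.one_le (S.idx s n k))
    have := len_pos hr n
    unfold gain
    positivity

/-- A lower bound for the Carleson norm of a step weight by a function that satisfies the
dynamic programming inequality along the scheme. -/
lemma le_upperConst (a : ℝ) {r : ℝ} (hr : 0 < r) {M : ℕ} (hM : ∀ k, S.τ (S.idx s M k) = 1)
    (hs : ∀ i, S.τ i ≤ S.τ s) {Φ : ℝ → ℝ} (hΦ : ∀ t, 1 ≤ t → 0 ≤ Φ t) {V : ℕ → ℕ → ℝ}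
    (hV : ∀ n i, V n i ≤ S.gain Φ n i + (V (n + 1) (S.up n i) + V (n + 1) (S.dn n i)) / 2)
    (hV0 : ∀ k, V M (S.idx s M k) ≤ 0) : ENNReal.ofReal (V 0 s) ≤ upperConst a r Φ (S.τ s) := by
  refine le_trans ?_ (le_iSup₂ (f := fun w (_ : IsWeight w ∧ characteristic a r w =
    ENNReal.ofReal (S.τ s)) => carlesonNorm r (coeff a r Φ w)) (S.weight s a r M)
    ⟨S.isWeight_weight s a r M, S.characteristic_weight a hr hM hs⟩)
  refine le_carlesonNorm hr (S.coeff_weight_nonneg a hr hM hΦ) (n := 0) (k := 0) (N := M) ?_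
  have key := le_sum_genSum (n := 0) (c := coeff a r Φ (S.weight s a r M))
    (v := fun n k => len r n * V n.toNat (S.idx s n.toNat k)) (fun m hm k => ?_) 0 M
  · have h0 : genSum (fun n k => len r n * V n.toNat (S.idx s n.toNat k)) 0 0 M ≤ 0 :=
      Finset.sum_nonpos fun i _ => by
        have : (0 + (M : ℤ)).toNat = M := by omega
        simp only [this]
        exact mul_nonpos_of_nonneg_of_nonpos (len_pos hr _).le (hV0 _)
    have e : S.idx s (0 : ℤ).toNat 0 = s := rfl
    rw [e, Int.toNat_zero] at key
    linarith
  · lift m to ℕ using hm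
    have e : ((m : ℤ) + 1).toNat = m + 1 := by omega
    simp only [e, Int.toNat_natCast, S.coeff_weight a hr hM, idx_left, idx_right]
    have := mul_le_mul_of_nonneg_left (hV m (S.idx s m k)) (len_pos hr m).le
    rw [len_succ r m] at this ⊢
    linarith

end Scheme

/-! ### Product weights. -/

/-- The scheme of the weights `∏ (1 + b rₙ)`, where `rₙ` are the first `N` Rademacher functions
and `b² = 1 - 1 / q`. -/
def productScheme (q : ℝ) (hq : 1 ≤ q) (N : ℕ) : Scheme where
  τ i := q ^ (min i N)
  p _ i := if min i N = 0 then 0 else √(1 - q⁻¹)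
  q _ i := if min i N = 0 then 0 else -√(1 - q⁻¹)
  up _ i := min i N - 1
  dn _ i := min i N - 1
  one_le i := one_le_pow₀ hq
  abs_p n i := by
    split_ifs
    · simp
    · rw [abs_of_nonneg (Real.sqrt_nonneg _), Real.sqrt_lt' one_pos]
      have : 0 < q⁻¹ := by positivity
      linarith
  τ_up n i := by
    have h1 : 0 ≤ 1 - q⁻¹ := by linarith [inv_le_one_of_one_le₀ hq]
    split_ifs with h
    · simp [h]
    · have e : min (min i N - 1) N = min i N - 1 := by omega
      have e2 : min i N = min i N - 1 + 1 := by omega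
      -- Opposite jumps ±b with 1 - b² = 1/q divide the product by q in both halves.
      have : (1 + √(1 - q⁻¹)) * (1 + -√(1 - q⁻¹)) = q⁻¹ := by
        have := Real.sq_sqrt h1
        linarith
      rw [e, this]
      nth_rw 2 [e2]
      rw [pow_succ]
      field_simp
  τ_dn n i := by
    have h1 : 0 ≤ 1 - q⁻¹ := by linarith [inv_le_one_of_one_le₀ hq]
    split_ifs with h
    · simp [h]
    · have e : min (min i N - 1) N = min i N - 1 := by omega
      have e2 : min i N = min i N - 1 + 1 := by omega
      have : (1 - √(1 - q⁻¹)) * (1 - -√(1 - q⁻¹)) = q⁻¹ := by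
        have := Real.sq_sqrt h1
        linarith
      rw [e, this]
      nth_rw 2 [e2]
      rw [pow_succ]
      field_simp
  p_eq n i h := by
    split_ifs with h0
    · rfl
    · rw [(pow_eq_one_iff_of_nonneg (by linarith) h0).1 h]; simp
  q_eq n i h := by
    split_ifs with h0
    · rfl
    · rw [(pow_eq_one_iff_of_nonneg (by linarith) h0).1 h]; simp

variable {q : ℝ} (hq : 1 ≤ q) (N : ℕ)

lemma productScheme_idx (n : ℕ) (k : ℤ) : (productScheme q hq N).idx N n k = N - n := by
  induction n generalizing k with
  | zero => rfl
  | succ n ih =>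
    rw [Scheme.idx, ih]
    simp only [productScheme, ite_self]
    omega

/-- The value of the Carleson norm of a product weight. -/
def productSum (q : ℝ) (Φ : ℝ → ℝ) (N : ℕ) : ℝ :=
  ∑ i ∈ Finset.range N, 8 * (1 - q⁻¹) * Φ (q ^ (i + 1))

lemma productScheme_gain (Φ : ℝ → ℝ) (n i : ℕ) :
    (productScheme q hq N).gain Φ n i + productSum q Φ (min i N - 1) =
      productSum q Φ (min i N) := by
  have h1 : 0 ≤ 1 - q⁻¹ := by linarith [inv_le_one_of_one_le₀ hq]
  simp only [Scheme.gain, productScheme]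
  split_ifs with h
  · simp [h]
  · have e2 : min i N = min i N - 1 + 1 := by omega
    conv_rhs => rw [e2, productSum, Finset.sum_range_succ, ← productSum]
    rw [← e2, neg_sq, Real.sq_sqrt h1]
    ring

lemma productSum_nonneg (hq : 1 ≤ q) {Φ : ℝ → ℝ} (hΦ : ∀ t, 1 ≤ t → 0 ≤ Φ t) (j : ℕ) :
    0 ≤ productSum q Φ j := Finset.sum_nonneg fun i _ => by
  have h1 : 0 ≤ 1 - q⁻¹ := by linarith [inv_le_one_of_one_le₀ hq]
  have := hΦ _ (one_le_pow₀ hq : 1 ≤ q ^ (i + 1))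
  positivity

lemma productScheme_τ (k : ℤ) :
    (productScheme q hq N).τ ((productScheme q hq N).idx N N k) = 1 := by
  rw [productScheme_idx]
  simp [productScheme]

lemma productScheme_τ_le (i : ℕ) : (productScheme q hq N).τ i ≤ (productScheme q hq N).τ N := by
  simp only [productScheme]
  exact pow_le_pow_right₀ hq (by omega)

include hq in
lemma productSum_le_upperConst (a : ℝ) {r : ℝ} (hr : 0 < r) {Φ : ℝ → ℝ}
    (hΦ : ∀ t, 1 ≤ t → 0 ≤ Φ t) :
    ENNReal.ofReal (productSum q Φ N) ≤ upperConst a r Φ (q ^ N) := by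
  have h := (productScheme q hq N).le_upperConst (s := N) (M := N) a hr (productScheme_τ hq N)
    (productScheme_τ_le hq N) hΦ (V := fun _ i => productSum q Φ (min i N)) (fun n i => ?_)
    (fun k => ?_)
  · simpa [productScheme] using h
  · rw [← productScheme_gain hq N Φ n i]
    simp [productScheme]
  · rw [productScheme_idx]; simp [productSum]

lemma lowerConst_le_productSum (hq : 1 ≤ q) (a : ℝ) {r : ℝ} (hr : 0 < r) {Φ : ℝ → ℝ}
    (hΦ : ∀ t, 1 ≤ t → 0 ≤ Φ t) :
    lowerConst a r Φ (q ^ N) ≤ ENNReal.ofReal (productSum q Φ N) := by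
  set S := productScheme q hq N with hS
  have hM := productScheme_τ hq N
  have hτ : S.τ N = q ^ N := by simp [hS, productScheme]
  have hc : characteristic a r (S.weight N a r N) = ENNReal.ofReal (q ^ N) := by
    rw [← hτ]
    exact S.characteristic_weight a hr hM (productScheme_τ_le hq N)
  refine le_trans (iInf₂_le (S.weight N a r N) ⟨S.isWeight_weight N a r N, hc⟩) ?_
  refine carlesonNorm_le hr (S.coeff_weight_nonneg a hr hM hΦ) fun n k L => ?_
  have key := sum_genSum_le (n := n) (c := coeff a r Φ (S.weight N a r N))
    (v := fun m _ => len r m * productSum q Φ (N - m.toNat)) (fun m _ l => ?_) k L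
  · have h1 := genSum_nonneg (c := fun m _ => len r m * productSum q Φ (N - m.toNat))
      (fun m l => mul_nonneg (len_pos hr m).le (productSum_nonneg hq hΦ _)) n k L
    have h2 : productSum q Φ (N - n.toNat) ≤ productSum q Φ N := by
      refine Finset.sum_le_sum_of_subset_of_nonneg (Finset.range_mono (by omega)) fun i _ _ => ?_
      have h1 : 0 ≤ 1 - q⁻¹ := by linarith [inv_le_one_of_one_le₀ hq]
      have := hΦ _ (one_le_pow₀ hq : 1 ≤ q ^ (i + 1))
      positivity
    have h3 := mul_le_mul_of_nonneg_left h2 (len_pos hr n).le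
    linarith
  · rcases lt_or_ge m 0 with h | h
    · have e1 : m.toNat = 0 := by omega
      have e2 : (m + 1).toNat = 0 := by omega
      rw [S.coeff_weight_of_neg a hr hM Φ h, e1, e2, len_succ r m]
      linarith
    · lift m to ℕ using h
      have e : ((m : ℤ) + 1).toNat = m + 1 := by omega
      have e1 : min (N - m) N = N - m := by omega
      have e2 : N - (m + 1) = N - m - 1 := by omega
      have hg := productScheme_gain hq N Φ m (N - m)
      rw [e1] at hg
      rw [S.coeff_weight a hr hM, productScheme_idx, e, Int.toNat_natCast, ← hg, e2,
        len_succ r m]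
      linarith

open Filter in
-- The expression is 8 q^(α-1) divided by the difference quotient of q^α at 1, whose limit is α.
lemma tendsto_one_sub_inv_mul_div {α : ℝ} (hα : α ≠ 0) :
    Tendsto (fun q : ℝ => 8 * (1 - q⁻¹) * (q ^ α / (q ^ α - 1))) (nhdsWithin 1 {1}ᶜ)
      (nhds (8 / α)) := by
  have h1 : HasDerivAt (fun q : ℝ => q ^ α) (α * 1 ^ (α - 1)) 1 :=
    Real.hasDerivAt_rpow_const (Or.inl one_ne_zero)
  rw [Real.one_rpow, mul_one, hasDerivAt_iff_tendsto_slope] at h1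
  have h2 := h1.inv₀ hα
  have h3 : ContinuousAt (fun q : ℝ => 8 * q ^ (α - 1)) 1 :=
    continuousAt_const.mul (Real.continuousAt_rpow_const _ _ (Or.inl one_ne_zero))
  have h4 := (h3.tendsto.mono_left (nhdsWithin_le_nhds (s := {1}ᶜ))).mul h2
  rw [Real.one_rpow, mul_one, ← div_eq_mul_inv] at h4
  refine h4.congr' ?_
  have hpos : ∀ᶠ q : ℝ in nhdsWithin 1 {1}ᶜ, 0 < q :=
    nhdsWithin_le_nhds (lt_mem_nhds one_pos)
  filter_upwards [hpos, self_mem_nhdsWithin] with q hq hq1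
  rw [slope_def_field, Real.one_rpow, Real.rpow_sub_one hq.ne', inv_div]
  field_simp

open Filter in
lemma tendsto_one_sub_inv_div_log :
    Tendsto (fun q : ℝ => 8 * (1 - q⁻¹) / Real.log q) (nhdsWithin 1 {1}ᶜ) (nhds 8) := by
  have h1 : HasDerivAt Real.log (1 : ℝ)⁻¹ 1 := Real.hasDerivAt_log one_ne_zero
  rw [inv_one, hasDerivAt_iff_tendsto_slope] at h1
  have h2 := h1.inv₀ one_ne_zero
  have h3 : ContinuousAt (fun q : ℝ => 8 * q⁻¹) 1 :=
    continuousAt_const.mul (continuousAt_inv₀ one_ne_zero)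
  have h4 := (h3.tendsto.mono_left (nhdsWithin_le_nhds (s := {1}ᶜ))).mul h2
  norm_num at h4
  refine h4.congr' ?_
  have hpos : ∀ᶠ q : ℝ in nhdsWithin 1 {1}ᶜ, 0 < q :=
    nhdsWithin_le_nhds (lt_mem_nhds one_pos)
  filter_upwards [hpos, self_mem_nhdsWithin] with q hq hq1
  rw [slope_def_field, Real.log_one, sub_zero, inv_div]
  field_simp

open Filter in
lemma tendsto_rpow_inv_nat {Q : ℝ} (hQ : 1 < Q) :
    Tendsto (fun N : ℕ => Q ^ (1 / ((N : ℝ) + 1))) atTop (nhdsWithin 1 {1}ᶜ) := by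
  refine tendsto_nhdsWithin_iff.2 ⟨?_, Eventually.of_forall fun N => ?_⟩
  · have h : ContinuousAt (fun x : ℝ => Q ^ x) 0 :=
      Real.continuousAt_const_rpow (by linarith)
    have := h.tendsto.comp tendsto_one_div_add_atTop_nhds_zero_nat
    simpa [Function.comp_def] using this
  · exact (Real.one_lt_rpow hQ (by positivity)).ne'

lemma productSum_rpow {q : ℝ} (hq : 1 < q) {α : ℝ} (hα : α ≠ 0) (N : ℕ) :
    productSum q (fun t => t ^ α) N =
      8 * (1 - q⁻¹) * (q ^ α / (q ^ α - 1)) * ((q ^ N) ^ α - 1) := by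
  have h0 : 0 ≤ q := by linarith
  have h1 : q ^ α ≠ 1 := fun h => by
    have := congrArg Real.log h
    rw [Real.log_rpow (by linarith), Real.log_one] at this
    exact (mul_ne_zero hα (Real.log_pos hq).ne') this
  have h2 : q ^ α - 1 ≠ 0 := sub_ne_zero.2 h1
  have e : ∀ i : ℕ, (q ^ i) ^ α = (q ^ α) ^ i := fun i => by
    rw [← Real.rpow_natCast, ← Real.rpow_mul h0, mul_comm, Real.rpow_mul h0, Real.rpow_natCast]
  simp only [productSum, e, ← Finset.mul_sum]
  rw [Finset.sum_congr rfl fun i _ => pow_succ (q ^ α) i, ← Finset.sum_mul, geom_sum_eq h1]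
  field_simp

open Filter in
-- With ratio q = Q^(1/(N+1)) these are Riemann sums of 8∫₁^Q t^(α-1) dt; being geometric, they are
-- summed exactly.
lemma tendsto_productSum_rpow {Q : ℝ} (hQ : 1 ≤ Q) {α : ℝ} (hα : α ≠ 0) :
    Tendsto (fun N : ℕ => productSum (Q ^ (1 / ((N : ℝ) + 1))) (fun t => t ^ α) (N + 1)) atTop
      (nhds (8 / α * (Q ^ α - 1))) := by
  rcases hQ.eq_or_lt with rfl | hQ
  · simp [productSum]
  refine (((tendsto_one_sub_inv_mul_div hα).comp (tendsto_rpow_inv_nat hQ)).mul_const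
    (Q ^ α - 1)).congr fun N => ?_
  rw [productSum_rpow (Real.one_lt_rpow hQ (by positivity)) hα, ← Real.rpow_mul_natCast
    (by linarith)]
  push_cast
  rw [one_div_mul_cancel (by positivity), Real.rpow_one]
  rfl

open Filter in
lemma tendsto_productSum_zero {Q : ℝ} (hQ : 1 ≤ Q) :
    Tendsto (fun N : ℕ => productSum (Q ^ (1 / ((N : ℝ) + 1))) (fun t => t ^ (0 : ℝ)) (N + 1))
      atTop (nhds (8 * Real.log Q)) := by
  rcases hQ.eq_or_lt with rfl | hQ
  · simp [productSum]
  refine ((tendsto_one_sub_inv_div_log.comp (tendsto_rpow_inv_nat hQ)).mul_const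
    (Real.log Q)).congr fun N => ?_
  have := Real.log_pos hQ
  simp only [productSum, Function.comp, Real.rpow_zero, Real.log_rpow (by linarith : 0 < Q),
    Finset.sum_const, Finset.card_range, nsmul_eq_mul]
  push_cast
  field_simp

lemma rpow_inv_pow {Q : ℝ} (hQ : 1 ≤ Q) (N : ℕ) : (Q ^ (1 / ((N : ℝ) + 1))) ^ (N + 1) = Q := by
  rw [← Real.rpow_mul_natCast (by linarith)]
  push_cast
  rw [one_div_mul_cancel (by positivity), Real.rpow_one]

lemma one_le_rpow_inv {Q : ℝ} (hQ : 1 ≤ Q) (N : ℕ) : 1 ≤ Q ^ (1 / ((N : ℝ) + 1)) :=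
  Real.one_le_rpow hQ (by positivity)

open Filter in
lemma le_upperConst_of_tendsto (a : ℝ) {r : ℝ} (hr : 0 < r) {Φ : ℝ → ℝ}
    (hΦ : ∀ t, 1 ≤ t → 0 ≤ Φ t) {Q K : ℝ} (hQ : 1 ≤ Q)
    (h : Tendsto (fun N : ℕ => productSum (Q ^ (1 / ((N : ℝ) + 1))) Φ (N + 1)) atTop (nhds K)) :
    ENNReal.ofReal K ≤ upperConst a r Φ Q := by
  refine le_of_tendsto ((ENNReal.continuous_ofReal.tendsto _).comp h)
    (Eventually.of_forall fun N => ?_)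
  have := productSum_le_upperConst (one_le_rpow_inv hQ N) (N + 1) a hr hΦ
  rwa [rpow_inv_pow hQ] at this

open Filter in
lemma lowerConst_le_of_tendsto (a : ℝ) {r : ℝ} (hr : 0 < r) {Φ : ℝ → ℝ}
    (hΦ : ∀ t, 1 ≤ t → 0 ≤ Φ t) {Q K : ℝ} (hQ : 1 ≤ Q)
    (h : Tendsto (fun N : ℕ => productSum (Q ^ (1 / ((N : ℝ) + 1))) Φ (N + 1)) atTop (nhds K)) :
    lowerConst a r Φ Q ≤ ENNReal.ofReal K := by
  refine ge_of_tendsto ((ENNReal.continuous_ofReal.tendsto _).comp h)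
    (Eventually.of_forall fun N => ?_)
  have := lowerConst_le_productSum (N + 1) (one_le_rpow_inv hQ N) a hr hΦ
  rwa [rpow_inv_pow hQ] at this

/-! ### Elementary Bellman functions. -/

lemma split_pos {p q : ℝ} (hp : |p| < 1) (hq : |q| < 1) :
    0 < (1 + p) * (1 + q) ∧ 0 < (1 - p) * (1 - q) := by
  rw [abs_lt] at hp hq
  exact ⟨mul_pos (by linarith) (by linarith), mul_pos (by linarith) (by linarith)⟩

/-- Bernoulli's inequality bounds the sum of the two α-th powers below by 2 + 2αpq, and p² + q² +
2pq is a square. -/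
lemma isSub_rpow (Q : ℝ) {α : ℝ} (hα : 1 ≤ α) :
    IsSub Q (fun t => t ^ α) (fun t => 8 / α * (t ^ α - 1)) := by
  intro t p q ht hp hq _ _
  obtain ⟨hu, hv⟩ := split_pos hp hq
  have ht0 : 0 < t := by linarith [ht.1]
  have hα0 : 0 < α := by linarith
  simp only [Real.mul_rpow ht0.le hu.le, Real.mul_rpow ht0.le hv.le]
  have b1 := one_add_mul_self_le_rpow_one_add (by linarith : -1 ≤ (1 + p) * (1 + q) - 1) hα
  have b2 := one_add_mul_self_le_rpow_one_add (by linarith : -1 ≤ (1 - p) * (1 - q) - 1) hα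
  rw [add_sub_cancel] at b1 b2
  set U := ((1 + p) * (1 + q)) ^ α
  set W := ((1 - p) * (1 - q)) ^ α
  have hT : 0 < t ^ α := Real.rpow_pos_of_pos ht0 α
  set T := t ^ α
  have key : 0 ≤ 4 * T / α * (U + W - 2 - 2 * α * (p * q)) + 4 * T * (p + q) ^ 2 := by
    refine add_nonneg (mul_nonneg (by positivity) (by linarith)) (by positivity)
  have e : 4 * T * (p ^ 2 + q ^ 2) + (8 / α * (T * U - 1) + 8 / α * (T * W - 1)) / 2
      - 8 / α * (T - 1) =
      4 * T / α * (U + W - 2 - 2 * α * (p * q)) + 4 * T * (p + q) ^ 2 := by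
    field_simp; ring
  linarith

/-- On [1, Q] one has t^α ≥ Q^(α-1) t, which reduces the claim to α = 1, where the excess is
4t(p+q)². -/
lemma isSub_linear {Q : ℝ} {α : ℝ} (hα : α ≤ 1) :
    IsSub Q (fun t => t ^ α) (fun t => 8 * Q ^ (α - 1) * (t - 1)) := by
  intro t p q ht hp hq _ _
  have ht0 : 0 < t := by linarith [ht.1]
  have h1 : Q ^ (α - 1) ≤ t ^ (α - 1) := Real.rpow_le_rpow_of_nonpos ht0 ht.2 (by linarith)
  have h2 : Q ^ (α - 1) * t ≤ t ^ α := by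
    rw [Real.rpow_sub_one ht0.ne', le_div_iff₀ ht0] at h1
    exact h1
  have h3 : 0 ≤ Q ^ (α - 1) := Real.rpow_nonneg (ht0.le.trans ht.2) _
  have h4 : 0 ≤ Q ^ (α - 1) * t * (p + q) ^ 2 := by positivity
  have h5 := mul_le_mul_of_nonneg_right h2 (by positivity : 0 ≤ p ^ 2 + q ^ 2)
  simp only
  nlinarith

/-- The product of the two factors is (1-p²)(1-q²), and log(1-x) ≤ -x. -/
lemma log_split_le {p q : ℝ} (hp : |p| < 1) (hq : |q| < 1) :
    Real.log ((1 + p) * (1 + q)) + Real.log ((1 - p) * (1 - q)) ≤ -(p ^ 2 + q ^ 2) := by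
  obtain ⟨hu, hv⟩ := split_pos hp hq
  have h1 : 0 < 1 - p ^ 2 := by nlinarith [sq_abs p, abs_nonneg p]
  have h2 : 0 < 1 - q ^ 2 := by nlinarith [sq_abs q, abs_nonneg q]
  rw [← Real.log_mul hu.ne' hv.ne',
    show (1 + p) * (1 + q) * ((1 - p) * (1 - q)) = (1 - p ^ 2) * (1 - q ^ 2) by ring,
    Real.log_mul h1.ne' h2.ne']
  linarith [Real.log_le_sub_one_of_pos h1, Real.log_le_sub_one_of_pos h2]

/-- Since x^α ≥ 1 + α log x, the claim follows from the logarithmic inequality, whose sign is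
reversed by α < 0. -/
lemma isSuper_rpow (Q : ℝ) {α : ℝ} (hα : α < 0) :
    IsSuper Q (fun t => t ^ α) (fun t => 8 / α * (t ^ α - 1)) := by
  intro t p q ht hp hq _ _
  obtain ⟨hu, hv⟩ := split_pos hp hq
  have ht0 : 0 < t := by linarith [ht.1]
  have hl := log_split_le hp hq
  have bd : ∀ x : ℝ, 0 < x → 1 + α * Real.log x ≤ x ^ α := fun x hx => by
    rw [Real.rpow_def_of_pos hx]
    linarith [Real.add_one_le_exp (Real.log x * α)]
  simp only [Real.mul_rpow ht0.le hu.le, Real.mul_rpow ht0.le hv.le]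
  have b1 := bd _ hu
  have b2 := bd _ hv
  set U := ((1 + p) * (1 + q)) ^ α
  set W := ((1 - p) * (1 - q)) ^ α
  have hT : 0 < t ^ α := Real.rpow_pos_of_pos ht0 α
  set T := t ^ α
  have h1 : 0 ≤ U + W - 2 + α * (p ^ 2 + q ^ 2) := by nlinarith
  have key : 4 * T / α * (U + W - 2 + α * (p ^ 2 + q ^ 2)) ≤ 0 :=
    mul_nonpos_of_nonpos_of_nonneg (div_nonpos_of_nonneg_of_nonpos (by positivity) hα.le) h1
  have e : 4 * T * (p ^ 2 + q ^ 2) + (8 / α * (T * U - 1) + 8 / α * (T * W - 1)) / 2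
      - 8 / α * (T - 1) = 4 * T / α * (U + W - 2 + α * (p ^ 2 + q ^ 2)) := by
    have := hα.ne
    field_simp; ring
  linarith

lemma isSuper_log (Q : ℝ) : IsSuper Q (fun t => t ^ (0 : ℝ)) (fun t => 8 * Real.log t) := by
  intro t p q ht hp hq _ _
  obtain ⟨hu, hv⟩ := split_pos hp hq
  have ht0 : 0 < t := by linarith [ht.1]
  have hl := log_split_le hp hq
  simp only [Real.rpow_zero, Real.log_mul ht0.ne' hu.ne', Real.log_mul ht0.ne' hv.ne']
  linarith

lemma IsSuper.combo {Q A B : ℝ} {Φ Φ₁ Φ₂ f₁ f₂ : ℝ → ℝ} (h₁ : IsSuper Q Φ₁ f₁)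
    (h₂ : IsSuper Q Φ₂ f₂) (hA : 0 ≤ A) (hB : 0 ≤ B)
    (h : ∀ t ∈ Set.Icc 1 Q, Φ t ≤ A * Φ₁ t + B * Φ₂ t) :
    IsSuper Q Φ (fun t => A * f₁ t + B * f₂ t) := by
  intro t p q ht hp hq hu hv
  have i1 := mul_le_mul_of_nonneg_left (h₁ t p q ht hp hq hu hv) hA
  have i2 := mul_le_mul_of_nonneg_left (h₂ t p q ht hp hq hu hv) hB
  have i3 := mul_le_mul_of_nonneg_right (h t ht) (by positivity : 0 ≤ 4 * (p ^ 2 + q ^ 2))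
  simp only
  linarith

/-! ### Bellman profiles in the variable √t. -/

lemma le_of_hasDerivAt_nonneg {g g' : ℝ → ℝ} {a b : ℝ} (hab : a ≤ b)
    (hg : ∀ x ∈ Set.Icc a b, HasDerivAt g (g' x) x) (h : ∀ x ∈ Set.Icc a b, 0 ≤ g' x) :
    g a ≤ g b := by
  refine monotoneOn_of_deriv_nonneg (convex_Icc a b)
    (fun x hx => (hg x hx).continuousAt.continuousWithinAt)
    (fun x hx => (hg x (interior_subset hx)).differentiableAt.differentiableWithinAt)
    (fun x hx => ?_) (Set.left_mem_Icc.2 hab) (Set.right_mem_Icc.2 hab) hab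
  rw [(hg x (interior_subset hx)).deriv]
  exact h x (interior_subset hx)

lemma nonneg_of_second_deriv_nonneg {g g' g'' : ℝ → ℝ} {d : ℝ} (hd : 0 ≤ d)
    (hg : ∀ x ∈ Set.Icc 0 d, HasDerivAt g (g' x) x)
    (hg' : ∀ x ∈ Set.Icc 0 d, HasDerivAt g' (g'' x) x) (h : ∀ x ∈ Set.Icc 0 d, 0 ≤ g'' x)
    (h0 : g 0 = 0) (h0' : g' 0 = 0) : 0 ≤ g d := by
  rw [← h0]
  refine le_of_hasDerivAt_nonneg hd hg fun x hx => ?_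
  rw [← h0']
  exact le_of_hasDerivAt_nonneg hx.1 (fun y hy => hg' y ⟨hy.1, hy.2.trans hx.2⟩)
    fun y hy => h y ⟨hy.1, hy.2.trans hx.2⟩

/-- The Bellman function as a function of `y = √t`: the solution of `F'' = -16 y ^ β` with
`F 1 = 0` and `F' Y = 16 Y ^ (β + 1)`. -/
structure Profile (β Y : ℝ) (F F' : ℝ → ℝ) : Prop where
  one_le : 1 ≤ Y
  one : F 1 = 0
  deriv : ∀ u, 0 < u → HasDerivAt F (F' u) u
  deriv' : ∀ u, 0 < u → HasDerivAt F' (-16 * u ^ β) u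
  top : F' Y = 16 * Y ^ (β + 1)

lemma two_mul_rpow_le {β : ℝ} (hβ : β ≤ 0 ∨ 1 ≤ β) {m x : ℝ} (hx : 0 ≤ x) (hm : x < m) :
    2 * m ^ β ≤ (m + x) ^ β + (m - x) ^ β := by
  have h1 : 0 < m + x := by linarith
  have h2 : 0 < m - x := by linarith
  have h0 : 0 < m := by linarith
  rcases hβ with hβ | hβ
  · have e : m ^ β * m ^ β ≤ (m + x) ^ β * (m - x) ^ β := by
      rw [← Real.mul_rpow h0.le h0.le, ← Real.mul_rpow h1.le h2.le]
      exact Real.rpow_le_rpow_of_nonpos (mul_pos h1 h2) (by nlinarith) hβ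
    have i1 := Real.rpow_pos_of_pos h1 β
    have i2 := Real.rpow_pos_of_pos h2 β
    have i0 := Real.rpow_pos_of_pos h0 β
    nlinarith [sq_nonneg ((m + x) ^ β - (m - x) ^ β)]
  · have := (convexOn_rpow hβ).2 (Set.mem_Ici.2 h1.le) (Set.mem_Ici.2 h2.le)
      (by norm_num : (0:ℝ) ≤ 1 / 2) (by norm_num : (0:ℝ) ≤ 1 / 2) (by norm_num)
    simp only [smul_eq_mul] at this
    rw [show 1 / 2 * (m + x) + 1 / 2 * (m - x) = m by ring] at this
    linarith

namespace Profile

variable {β Y : ℝ} {F F' : ℝ → ℝ}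

lemma hasDerivAt_add (h : Profile β Y F F') {m x : ℝ} (hm : 0 < m + x) :
    HasDerivAt (fun x => F (m + x)) (F' (m + x)) x ∧
    HasDerivAt (fun x => F' (m + x)) (-16 * (m + x) ^ β) x :=
  ⟨(h.deriv _ hm).comp_const_add m x, (h.deriv' _ hm).comp_const_add m x⟩

lemma hasDerivAt_sub (h : Profile β Y F F') {m x : ℝ} (hm : 0 < m - x) :
    HasDerivAt (fun x => F (m - x)) (-F' (m - x)) x ∧
    HasDerivAt (fun x => F' (m - x)) (-(-16 * (m - x) ^ β)) x :=
  ⟨(h.deriv _ hm).comp_const_sub m x, (h.deriv' _ hm).comp_const_sub m x⟩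

/-- Both sides vanish to first order at d = 0, and their second derivatives in d are compared by
midpoint convexity of u^β. -/
lemma le_second_diff (h : Profile β Y F F') (hβ : β ≤ 0 ∨ 1 ≤ β) {m d : ℝ} (hd : 0 ≤ d)
    (hm : d < m) : 16 * m ^ β * d ^ 2 ≤ 2 * F m - F (m + d) - F (m - d) := by
  have key := nonneg_of_second_deriv_nonneg
    (g := fun x => 2 * F m - F (m + x) - F (m - x) - 16 * m ^ β * x ^ 2)
    (g' := fun x => -F' (m + x) + F' (m - x) - 32 * m ^ β * x)
    (g'' := fun x => 16 * (m + x) ^ β + 16 * (m - x) ^ β - 32 * m ^ β) hd ?_ ?_ ?_ ?_ ?_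
  · linarith
  · intro x hx
    refine ((((h.hasDerivAt_add (by linarith [hx.1])).1.const_sub (2 * F m)).sub
      (h.hasDerivAt_sub (by linarith [hx.2])).1).sub
      ((hasDerivAt_pow 2 x).const_mul (16 * m ^ β))).congr_deriv ?_
    norm_num; ring
  · intro x hx
    refine (((h.hasDerivAt_add (by linarith [hx.1])).2.neg.add
      (h.hasDerivAt_sub (by linarith [hx.2])).2).sub
      ((hasDerivAt_id x).const_mul (32 * m ^ β))).congr_deriv ?_
    ring
  · intro x hx
    have := two_mul_rpow_le hβ hx.1 (hx.2.trans_lt hm)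
    linarith
  · norm_num; ring
  · norm_num

/-- The reverse estimate, used for the random walk; bounding u^β on the window replaces convexity,
so every β is allowed. -/
lemma second_diff_le (h : Profile β Y F F') {m d L : ℝ} (hd : 0 ≤ d) (hm : d < m)
    (hL : ∀ u ∈ Set.Icc (m - d) (m + d), u ^ β ≤ L) :
    2 * F m - F (m + d) - F (m - d) ≤ 16 * L * d ^ 2 := by
  have key := nonneg_of_second_deriv_nonneg
    (g := fun x => 16 * L * x ^ 2 - (2 * F m - F (m + x) - F (m - x)))
    (g' := fun x => 32 * L * x - (-F' (m + x) + F' (m - x)))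
    (g'' := fun x => 32 * L - (16 * (m + x) ^ β + 16 * (m - x) ^ β)) hd ?_ ?_ ?_ ?_ ?_
  · linarith
  · intro x hx
    refine (((hasDerivAt_pow 2 x).const_mul (16 * L)).sub
      (((h.hasDerivAt_add (by linarith [hx.1])).1.const_sub (2 * F m)).sub
      (h.hasDerivAt_sub (by linarith [hx.2])).1)).congr_deriv ?_
    norm_num; ring
  · intro x hx
    refine (((hasDerivAt_id x).const_mul (32 * L)).sub
      ((h.hasDerivAt_add (by linarith [hx.1])).2.neg.add
      (h.hasDerivAt_sub (by linarith [hx.2])).2)).congr_deriv ?_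
    ring
  · intro x hx
    have i1 := hL (m + x) ⟨by linarith [hx.1], by linarith [hx.2]⟩
    have i2 := hL (m - x) ⟨by linarith [hx.2], by linarith [hx.1]⟩
    linarith
  · norm_num; ring
  · norm_num

lemma antitone (h : Profile β Y F F') {u z : ℝ} (hu : 0 < u) (huz : u ≤ z) : F' z ≤ F' u := by
  have := le_of_hasDerivAt_nonneg (g := fun x => -F' x) (g' := fun x => -(-16 * x ^ β)) huz
    (fun x hx => (h.deriv' x (hu.trans_le hx.1)).neg)
    (fun x hx => by
      have := Real.rpow_pos_of_pos (hu.trans_le hx.1) β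
      linarith)
  linarith

/-- F'(x) - 16x^(β+1) has derivative -16(β+2)x^β ≤ 0 and vanishes at Y, so it is nonnegative at z;
and F' decreases from u to z. -/
lemma le_deriv (h : Profile β Y F F') (hβ : -2 ≤ β) {u z : ℝ} (hu : 0 < u) (huz : u ≤ z)
    (hz : z ≤ Y) : 16 * z ^ (β + 1) ≤ F' u := by
  refine le_trans ?_ (h.antitone hu huz)
  have hz0 := hu.trans_le huz
  have := le_of_hasDerivAt_nonneg (g := fun x => -(F' x - 16 * x ^ (β + 1)))
    (g' := fun x => -(-16 * x ^ β - 16 * ((β + 1) * x ^ (β + 1 - 1)))) hz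
    (fun x hx => ((h.deriv' x (hz0.trans_le hx.1)).sub
      ((Real.hasDerivAt_rpow_const (Or.inl (hz0.trans_le hx.1).ne')).const_mul 16)).neg)
    (fun x hx => by
      have := Real.rpow_pos_of_pos (hz0.trans_le hx.1) β
      rw [add_sub_cancel_right]
      nlinarith)
  have := h.top
  linarith

lemma le_diff (h : Profile β Y F F') (hβ : -2 ≤ β) {u v z : ℝ} (hu : 0 < u) (huv : u ≤ v)
    (hvz : v ≤ z) (hz : z ≤ Y) : 16 * z ^ (β + 1) * (v - u) ≤ F v - F u := by
  have := le_of_hasDerivAt_nonneg (g := fun x => F x - 16 * z ^ (β + 1) * x)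
    (g' := fun x => F' x - 16 * z ^ (β + 1) * 1) huv
    (fun x hx => (h.deriv x (hu.trans_le hx.1)).sub ((hasDerivAt_id x).const_mul _))
    (fun x hx => by
      have := h.le_deriv hβ (hu.trans_le hx.1) (hx.2.trans hvz) hz
      linarith)
  linarith

lemma diff_le (h : Profile β Y F F') {u v : ℝ} (hu : 0 < u) (huv : u ≤ v) :
    F v - F u ≤ F' u * (v - u) := by
  have := le_of_hasDerivAt_nonneg (g := fun x => F' u * x - F x)
    (g' := fun x => F' u * 1 - F' x) huv
    (fun x hx => ((hasDerivAt_id x).const_mul _).sub (h.deriv x (hu.trans_le hx.1)))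
    (fun x hx => by
      have := h.antitone hu hx.1
      linarith)
  linarith

lemma mono (h : Profile β Y F F') (hβ : -2 ≤ β) {u v : ℝ} (hu : 0 < u) (huv : u ≤ v)
    (hv : v ≤ Y) : F u ≤ F v := by
  have h1 := h.le_diff hβ hu huv le_rfl hv
  have h2 := Real.rpow_pos_of_pos (hu.trans_le huv) (β + 1)
  have h3 : 0 ≤ 16 * v ^ (β + 1) * (v - u) := mul_nonneg (by positivity) (by linarith)
  linarith

lemma nonneg (h : Profile β Y F F') (hβ : -2 ≤ β) {u : ℝ} (hu : 1 ≤ u) (hv : u ≤ Y) : 0 ≤ F u := by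
  rw [← h.one]; exact h.mono hβ one_pos hu hv

end Profile

/-! ### The main inequality for profiles. -/

/-- Since m^β ≥ 1, the difference of the two sides is at least (1-m)² + 2d²(1-m²). -/
lemma normalized_of_nonpos {β m d : ℝ} (hβ : β ≤ 0) (hm0 : 0 < m) (hm : m ≤ 1) :
    (1 - m ^ 2) - d ^ 2 * (1 - 2 * m ^ 2) ≤ 2 * (1 - m) + m ^ β * d ^ 2 := by
  have h1 : 1 ≤ m ^ β := Real.one_le_rpow_of_pos_of_le_one_of_nonpos hm0 hm hβ
  have h2 := mul_le_mul_of_nonneg_right h1 (sq_nonneg d)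
  have h3 : 0 ≤ d ^ 2 * (1 - m ^ 2) := mul_nonneg (sq_nonneg d) (by nlinarith)
  nlinarith [sq_nonneg (1 - m)]

lemma normalized_of_one_le {β m d g : ℝ} (hβ : 1 ≤ β) (hm0 : 0 < m) (hm : m ≤ 1) (hd : 0 ≤ d)
    (hg : 0 ≤ g) (hg1 : g ≤ 1) (hdg : d ≤ g + (1 - m)) :
    (1 - m ^ 2) - d ^ 2 * (1 - 2 * m ^ 2) ≤ 2 * (1 + g) ^ (β + 1) * (1 - m) + m ^ β * d ^ 2 := by
  have h1 : 1 + (β + 1) * g ≤ (1 + g) ^ (β + 1) :=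
    one_add_mul_self_le_rpow_one_add (by linarith) (by linarith)
  have h2 : 0 ≤ m ^ β := Real.rpow_nonneg hm0.le β
  have h3 : 1 + β * (m - 1) ≤ m ^ β := by
    have := one_add_mul_self_le_rpow_one_add (by linarith : -1 ≤ m - 1) hβ
    rwa [add_sub_cancel] at this
  set e := 1 - m with he
  have hme : m = 1 - e := by rw [he]; ring
  have he0 : 0 ≤ e := by linarith
  set N := -(1 + m ^ β - 2 * m ^ 2) with hN
  have h4 : 2 * (1 + (β + 1) * g) * e ≤ 2 * (1 + g) ^ (β + 1) * e := by
    have := mul_le_mul_of_nonneg_right h1 he0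
    linarith
  -- Bernoulli's inequality has made the slope term linear in g; N is the amount by which the d²
  -- terms work against the claim.
  suffices hs : d ^ 2 * N ≤ 2 * (β + 1) * g * e + e ^ 2 by
    have : d ^ 2 * N = -(d ^ 2 * (1 - 2 * m ^ 2)) - m ^ β * d ^ 2 := by rw [hN]; ring
    rw [hme] at *
    nlinarith
  rcases le_or_gt N 0 with hN0 | hN0
  · have : d ^ 2 * N ≤ 0 := mul_nonpos_of_nonneg_of_nonpos (sq_nonneg d) hN0
    have : 0 ≤ (β + 1) * g * e := by positivity
    nlinarith [sq_nonneg e]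
  -- Expand (g+e)²N: the terms e²N and 2geN use N ≤ 1, while g²N uses g ≤ 1 and N ≤ βe.
  · have hN1 : N ≤ 1 := by nlinarith
    have hNe : N ≤ β * e := by nlinarith
    have hd2 : d ^ 2 ≤ (g + e) ^ 2 := by gcongr
    have i1 : d ^ 2 * N ≤ (g + e) ^ 2 * N := by gcongr
    have i2 : e ^ 2 * N ≤ e ^ 2 * 1 := by gcongr
    have i3 : g * e * N ≤ g * e * 1 := by gcongr
    have i4 : g ^ 2 * N ≤ g * (β * e) := by
      calc g ^ 2 * N ≤ g * N := by gcongr; nlinarith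
        _ ≤ g * (β * e) := by gcongr
    nlinarith [mul_nonneg (mul_nonneg (by linarith : 0 ≤ β) hg) he0]

namespace Profile

variable {β Y : ℝ} {F F' : ℝ → ℝ}

/-- The main inequality for one splitting, the coordinates being normalized by `y`. -/
lemma main_inequality (h : Profile β Y F F') (hβ : (-2 ≤ β ∧ β ≤ 0) ∨ 1 ≤ β) {y m d : ℝ}
    (hy0 : 0 < y) (hyY : y ≤ Y) (hd : 0 ≤ d) (hdm : d < m) (hm : m ≤ 1)
    (hY : y * (m + d) ≤ Y) :
    16 * y ^ (β + 2) * ((1 - m ^ 2) - d ^ 2 * (1 - 2 * m ^ 2)) ≤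
      2 * F y - F (y * (m + d)) - F (y * (m - d)) := by
  have hm0 : 0 < m := by linarith
  have hβ' : β ≤ 0 ∨ 1 ≤ β := hβ.imp_left fun h => h.2
  have hβ2 : -2 ≤ β := by rcases hβ with h | h <;> [exact h.1; linarith]
  have e2 : y ^ (β + 2) = y ^ β * y ^ 2 := by
    rw [Real.rpow_add hy0]; norm_num
  have hyβ := Real.rpow_pos_of_pos hy0 β
  have h2 := h.le_second_diff hβ' (mul_nonneg hy0.le hd) (mul_lt_mul_of_pos_left hdm hy0)
  rw [Real.mul_rpow hy0.le hm0.le, ← mul_add, ← mul_sub] at h2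
  have hmy : y * m ≤ y := by nlinarith
  rcases hβ with hβ | hβ
  · have h1 := h.le_diff hβ2 (mul_pos hy0 hm0) hmy le_rfl hyY
    rw [Real.rpow_add_one hy0.ne'] at h1
    have h3 := mul_le_mul_of_nonneg_left (normalized_of_nonpos (d := d) hβ.2 hm0 hm)
      (by positivity : 0 ≤ 16 * (y ^ β * y ^ 2))
    rw [e2]
    linarith
  -- The point y(1+g) is the larger of y and y(m+d), both known to be at most Y. The slope bound
  -- taken at y itself is too weak for large β.
  · obtain ⟨g, hg⟩ : ∃ g, g = max 0 (m + d - 1) := ⟨_, rfl⟩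
    have hg0 : 0 ≤ g := hg ▸ le_max_left _ _
    have hg1 : m + d - 1 ≤ g := hg ▸ le_max_right _ _
    have hg2 : g ≤ 1 := by rw [hg]; exact max_le zero_le_one (by linarith)
    have hgY : y * (1 + g) ≤ Y := by
      rcases max_choice 0 (m + d - 1) with hc | hc <;> rw [hg, hc]
      · simpa using hyY
      · simpa using hY
    have h1 := h.le_diff hβ2 (mul_pos hy0 hm0) hmy (by nlinarith) hgY
    rw [Real.mul_rpow hy0.le (by linarith), Real.rpow_add_one hy0.ne'] at h1
    have h3 := mul_le_mul_of_nonneg_left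
      (normalized_of_one_le hβ hm0 hm hd hg0 hg2 (by linarith))
      (by positivity : 0 ≤ 16 * (y ^ β * y ^ 2))
    rw [e2]
    linarith

lemma main_inequality' (h : Profile β Y F F') (hβ : (-2 ≤ β ∧ β ≤ 0) ∨ 1 ≤ β) {y A B p q : ℝ}
    (hy0 : 0 < y) (hyY : y ≤ Y) (hp : |p| < 1) (hq : |q| < 1) (hB : 0 < B) (hBA : B ≤ A)
    (hA2 : A ^ 2 = (1 + p) * (1 + q)) (hB2 : B ^ 2 = (1 - p) * (1 - q)) (hY : y * A ≤ Y) :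
    8 * y ^ (β + 2) * (p ^ 2 + q ^ 2) + F (y * A) + F (y * B) ≤ 2 * F y := by
  have hpq : p * q < 1 := by
    have := (abs_mul p q) ▸ mul_lt_one_of_nonneg_of_lt_one_left (abs_nonneg p) hp hq.le
    exact (le_abs_self _).trans_lt this
  -- Indeed (AB)² = (1-p²)(1-q²) ≤ (1-pq)². Together with A² + B² = 2 + 2pq this gives A + B ≤ 2.
  have hAB : A * B ≤ 1 - p * q := by
    refine abs_le_of_sq_le_sq' ?_ (by linarith) |>.2
    rw [mul_pow, hA2, hB2]
    nlinarith [sq_nonneg (p - q)]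
  have hm : (A + B) / 2 ≤ 1 := by nlinarith
  have key := h.main_inequality hβ (m := (A + B) / 2) (d := (A - B) / 2) hy0 hyY (by linarith)
    (by linarith) hm (by convert hY using 2; ring)
  rw [show (A + B) / 2 + (A - B) / 2 = A by ring, show (A + B) / 2 - (A - B) / 2 = B by ring] at key
  -- Recovers p² + q² from A and B: half of A² + B² is 1 + pq, and A² - B² = 2(p+q).
  have e : 1 - ((A + B) / 2) ^ 2 - ((A - B) / 2) ^ 2 * (1 - 2 * ((A + B) / 2) ^ 2) =
      (p ^ 2 + q ^ 2) / 2 := by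
    have : 1 - ((A + B) / 2) ^ 2 - ((A - B) / 2) ^ 2 * (1 - 2 * ((A + B) / 2) ^ 2) =
      1 - (A ^ 2 + B ^ 2) / 2 + (A ^ 2 - B ^ 2) ^ 2 / 8 := by ring
    rw [this, hA2, hB2]; ring
  rw [e] at key
  linarith

lemma isSuper (h : Profile β Y F F') (hβ : (-2 ≤ β ∧ β ≤ 0) ∨ 1 ≤ β) :
    IsSuper (Y ^ 2) (fun t => t ^ ((β + 2) / 2)) (fun t => F √t) := by
  intro t p q ht hp hq hu hv
  have ht0 : 0 < t := by linarith [ht.1]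
  have hY0 : 0 ≤ Y := by linarith [h.one_le]
  have hy0 : 0 < √t := Real.sqrt_pos.2 ht0
  obtain ⟨hA, hB⟩ := split_pos hp hq
  have hA' := Real.sqrt_pos.2 hA
  have hB' := Real.sqrt_pos.2 hB
  have le : ∀ x, x ≤ Y ^ 2 → √x ≤ Y := fun x hx => Real.sqrt_le_iff.2 ⟨hY0, hx⟩
  have e1 := le _ hu.2
  have e2 := le _ hv.2
  have e : t ^ ((β + 2) / 2) = √t ^ (β + 2) := by
    rw [Real.sqrt_eq_rpow, ← Real.rpow_mul ht0.le]; congr 1; ring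
  simp only
  rw [e]
  rw [Real.sqrt_mul ht0.le] at e1 e2 ⊢
  rw [Real.sqrt_mul ht0.le]
  rcases le_total (√((1 - p) * (1 - q))) (√((1 + p) * (1 + q))) with hc | hc
  · have := h.main_inequality' hβ hy0 (le _ ht.2) hp hq hB' hc (Real.sq_sqrt hA.le)
      (Real.sq_sqrt hB.le) e1
    linarith
  -- Changing the signs of both jumps exchanges the two halves.
  · have := h.main_inequality' hβ (p := -p) (q := -q) hy0 (le _ ht.2) (by rwa [abs_neg])
      (by rwa [abs_neg]) hA' hc
      (by rw [Real.sq_sqrt hB.le]; ring) (by rw [Real.sq_sqrt hA.le]; ring) e2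
    linarith [neg_sq p, neg_sq q]

lemma upperConst_le (h : Profile β Y F F') (hβ : (-2 ≤ β ∧ β ≤ 0) ∨ 1 ≤ β) (a : ℝ) {r : ℝ}
    (hr : 0 < r) :
    upperConst a r (fun t => t ^ ((β + 2) / 2)) (Y ^ 2) ≤ ENNReal.ofReal (F Y) := by
  have hY0 : 0 ≤ Y := by linarith [h.one_le]
  have hβ2 : -2 ≤ β := by rcases hβ with h | h <;> [exact h.1; linarith]
  have le : ∀ x ∈ Set.Icc 1 (Y ^ 2), 1 ≤ √x ∧ √x ≤ Y := fun x hx =>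
    ⟨Real.one_le_sqrt.2 hx.1, Real.sqrt_le_iff.2 ⟨hY0, hx.2⟩⟩
  refine DyadicCarleson.upperConst_le a hr (one_le_pow₀ h.one_le)
    (fun t ht => Real.rpow_nonneg (by linarith) _) (h.isSuper hβ) (fun t ht => ?_) fun t ht => ?_
  · exact h.nonneg hβ2 (le t ht).1 (le t ht).2
  · exact h.mono hβ2 (by linarith [(le t ht).1]) (le t ht).2 le_rfl

end Profile

/-! ### Stationary schemes and the reflected random walk. -/

namespace Scheme

/-- The scheme that follows a given one up to time `M`, and then splits into two points with
product `1`. -/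
def cut (S : Scheme) (h0 : S.τ 0 = 1) (M : ℕ) : Scheme where
  τ := S.τ
  p n i := if n < M then S.p 0 i else √(1 - (S.τ i)⁻¹)
  q n i := if n < M then S.q 0 i else -√(1 - (S.τ i)⁻¹)
  -- Index 0 is a state with product 1, by `h0`; opposite jumps with 1 - p² = 1/τ reach it in one
  -- split.
  up n i := if n < M then S.up 0 i else 0
  dn n i := if n < M then S.dn 0 i else 0
  one_le := S.one_le
  abs_p n i := by
    split_ifs
    · exact S.abs_p 0 i
    · rw [abs_of_nonneg (Real.sqrt_nonneg _), Real.sqrt_lt' one_pos]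
      have := inv_pos.2 (lt_of_lt_of_le one_pos (S.one_le i))
      linarith
  τ_up n i := by
    split_ifs
    · exact S.τ_up 0 i
    · have h1 : 0 < S.τ i := lt_of_lt_of_le one_pos (S.one_le i)
      have h2 := Real.sq_sqrt (by linarith [inv_le_one_of_one_le₀ (S.one_le i)] :
        0 ≤ 1 - (S.τ i)⁻¹)
      have h3 : (1 + √(1 - (S.τ i)⁻¹)) * (1 + -√(1 - (S.τ i)⁻¹)) = (S.τ i)⁻¹ := by linarith
      rw [h0, h3, mul_inv_cancel₀ h1.ne']
  τ_dn n i := by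
    split_ifs
    · exact S.τ_dn 0 i
    · have h1 : 0 < S.τ i := lt_of_lt_of_le one_pos (S.one_le i)
      have h2 := Real.sq_sqrt (by linarith [inv_le_one_of_one_le₀ (S.one_le i)] :
        0 ≤ 1 - (S.τ i)⁻¹)
      have h3 : (1 - √(1 - (S.τ i)⁻¹)) * (1 - -√(1 - (S.τ i)⁻¹)) = (S.τ i)⁻¹ := by linarith
      rw [h0, h3, mul_inv_cancel₀ h1.ne']
  p_eq n i h := by
    split_ifs
    · exact S.p_eq 0 i h
    · simp [h]
  q_eq n i h := by
    split_ifs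
    · exact S.q_eq 0 i h
    · simp [h]

lemma τ_idx_cut (S : Scheme) (h0 : S.τ 0 = 1) (M s : ℕ) (k : ℤ) :
    (S.cut h0 M).τ ((S.cut h0 M).idx s (M + 1) k) = 1 := by
  rw [idx]
  simp [cut, h0]

lemma gain_nonneg (S : Scheme) {Φ : ℝ → ℝ} (hΦ : ∀ t, 1 ≤ t → 0 ≤ Φ t) (n i : ℕ) :
    0 ≤ S.gain Φ n i := by
  have := hΦ _ (S.one_le i)
  unfold gain
  positivity

open Filter in
-- A stationary subsolution G need not vanish at time M, where the scheme is cut. The factor 1 -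
-- (1-δ)^(M-n) forces this, keeps the inequality because δG is at most the gain, and at time 0 tends
-- to 1 as M grows.
lemma le_upperConst_of_stationary (S : Scheme) (h0 : S.τ 0 = 1) (a : ℝ) {r : ℝ} (hr : 0 < r)
    {s : ℕ} (hs : ∀ i, S.τ i ≤ S.τ s) {Φ : ℝ → ℝ} (hΦ : ∀ t, 1 ≤ t → 0 ≤ Φ t) {G : ℕ → ℝ}
    (hG : ∀ i, G i ≤ S.gain Φ 0 i + (G (S.up 0 i) + G (S.dn 0 i)) / 2) {δ : ℝ} (hδ : 0 < δ)
    (hδ1 : δ < 1) (hGδ : ∀ i, δ * G i ≤ S.gain Φ 0 i) :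
    ENNReal.ofReal (G s) ≤ upperConst a r Φ (S.τ s) := by
  have ht : Tendsto (fun M : ℕ => ENNReal.ofReal ((1 - (1 - δ) ^ M) * G s)) atTop
      (nhds (ENNReal.ofReal (G s))) := by
    refine (ENNReal.continuous_ofReal.tendsto _).comp ?_
    simpa using ((tendsto_pow_atTop_nhds_zero_of_lt_one (by linarith : 0 ≤ 1 - δ)
      (by linarith)).const_sub 1).mul_const (G s)
  refine le_of_tendsto ht (Eventually.of_forall fun M => ?_)
  refine (S.cut h0 M).le_upperConst (s := s) a hr (S.τ_idx_cut h0 M s) hs hΦ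
    (V := fun n i => (1 - (1 - δ) ^ (M - n)) * G i) (fun n i => ?_) fun k => ?_
  · rcases lt_or_ge n M with hn | hn
    · have hg : (S.cut h0 M).gain Φ n i = S.gain Φ 0 i := by simp [gain, cut, hn]
      have hu : (S.cut h0 M).up n i = S.up 0 i := by simp [cut, hn]
      have hd : (S.cut h0 M).dn n i = S.dn 0 i := by simp [cut, hn]
      have e : M - n = M - (n + 1) + 1 := by omega
      simp only [hg, hu, hd]
      rw [e, pow_succ]
      set R := (1 - δ) ^ (M - (n + 1)) with hR
      have hR0 : 0 ≤ R := pow_nonneg (by linarith) _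
      have hR1 : R ≤ 1 := pow_le_one₀ (by linarith) (by linarith)
      have i1 := mul_le_mul_of_nonneg_left (hG i) (by linarith : 0 ≤ 1 - R)
      have i2 := mul_le_mul_of_nonneg_left (hGδ i) hR0
      linarith
    · have e1 : M - n = 0 := by omega
      have e2 : M - (n + 1) = 0 := by omega
      simpa [e1, e2] using (S.cut h0 M).gain_nonneg hΦ n i
  · simp

end Scheme

/-- The `i`-th point of the grid `1, 1 + h, …, 1 + N h`. -/
def gridPoint (h : ℝ) (N i : ℕ) : ℝ := 1 + min (i : ℝ) N * h

section Grid

variable {h : ℝ} {N : ℕ}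

lemma one_le_gridPoint (hh : 0 < h) (i : ℕ) : 1 ≤ gridPoint h N i := by
  have : 0 ≤ min (i : ℝ) N * h := by positivity
  unfold gridPoint; linarith

lemma one_add_le_gridPoint (hh : 0 < h) (hN : 0 < N) {i : ℕ} (hi : i ≠ 0) :
    1 + h ≤ gridPoint h N i := by
  have h1 : (1 : ℝ) ≤ min (i : ℝ) N :=
    le_min (by exact_mod_cast Nat.one_le_iff_ne_zero.2 hi) (by exact_mod_cast hN)
  unfold gridPoint
  nlinarith

lemma gridPoint_succ {i : ℕ} (hi : i < N) : gridPoint h N (i + 1) = gridPoint h N i + h := by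
  have h1 : ((i + 1 : ℕ) : ℝ) ≤ N := by exact_mod_cast hi
  have h2 : (i : ℝ) ≤ N := by exact_mod_cast hi.le
  unfold gridPoint
  rw [min_eq_left h1, min_eq_left h2]
  push_cast; ring

lemma gridPoint_pred {i : ℕ} (hi0 : i ≠ 0) (hi : i ≤ N) :
    gridPoint h N (i - 1) = gridPoint h N i - h := by
  obtain ⟨j, rfl⟩ := Nat.exists_eq_succ_of_ne_zero hi0
  have := gridPoint_succ (h := h) (N := N) (i := j) (by omega)
  simp only [Nat.succ_eq_add_one, Nat.add_sub_cancel] at *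
  linarith

lemma gridPoint_of_le {i : ℕ} (hi : N ≤ i) : gridPoint h N i = gridPoint h N N := by
  have h1 : (N : ℝ) ≤ i := by exact_mod_cast hi
  unfold gridPoint
  rw [min_eq_right h1, min_self]

lemma gridPoint_le (hh : 0 < h) (i : ℕ) : gridPoint h N i ≤ gridPoint h N N := by
  unfold gridPoint
  rw [min_self]
  have := min_le_right (i : ℝ) N
  nlinarith

/-- The scheme in which `√t` performs a simple random walk on a grid in `[1, 1 + N h]`, with
absorption at `1` and reflection at the other end. -/
def walkScheme (h : ℝ) (hh : 0 < h) (N : ℕ) (hN : 0 < N) : Scheme where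
  τ i := gridPoint h N i ^ 2
  -- At an interior point x equal jumps h/x move √t to x ± h. At the top opposite jumps with 1 - p²
  -- = ((x-h)/x)² send both halves to x - h.
  p _ i := if i = 0 then 0 else if i < N then h / gridPoint h N i
    else √(1 - ((gridPoint h N i - h) / gridPoint h N i) ^ 2)
  q _ i := if i = 0 then 0 else if i < N then h / gridPoint h N i
    else -√(1 - ((gridPoint h N i - h) / gridPoint h N i) ^ 2)
  up _ i := if i = 0 then 0 else if i < N then i + 1 else N - 1
  dn _ i := if i = 0 then 0 else if i < N then i - 1 else N - 1
  one_le i := one_le_pow₀ (one_le_gridPoint hh i)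
  abs_p n i := by
    split_ifs with h0 h1
    · simp
    · have := one_add_le_gridPoint hh hN h0
      rw [abs_of_nonneg (div_nonneg hh.le (by linarith)), div_lt_one (by linarith)]
      linarith
    · have := one_add_le_gridPoint hh hN h0
      rw [abs_of_nonneg (Real.sqrt_nonneg _), Real.sqrt_lt' one_pos]
      have : 0 < (gridPoint h N i - h) / gridPoint h N i := div_pos (by linarith) (by linarith)
      nlinarith
  τ_up n i := by
    split_ifs with h0 h1
    · simp [h0]
    · have := one_add_le_gridPoint hh hN h0
      have h2 : gridPoint h N i ≠ 0 := by linarith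
      rw [gridPoint_succ h1]
      field_simp
    · have h3 := one_add_le_gridPoint hh hN h0
      have h2 : gridPoint h N i ≠ 0 := by linarith
      have h4 : (gridPoint h N i - h) / gridPoint h N i ≤ 1 := by
        rw [div_le_one (by linarith)]; linarith
      have h5 : 0 ≤ (gridPoint h N i - h) / gridPoint h N i :=
        div_nonneg (by linarith) (by linarith)
      have h6 := Real.sq_sqrt (by nlinarith : 0 ≤ 1 - ((gridPoint h N i - h) / gridPoint h N i) ^ 2)
      rw [gridPoint_pred hN.ne' le_rfl, ← gridPoint_of_le (not_lt.1 h1)]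
      set R := √(1 - ((gridPoint h N i - h) / gridPoint h N i) ^ 2)
      rw [show (1 + R) * (1 + -R) = 1 - R ^ 2 by ring, h6]
      field_simp
      ring
  τ_dn n i := by
    split_ifs with h0 h1
    · simp [h0]
    · have := one_add_le_gridPoint hh hN h0
      have h2 : gridPoint h N i ≠ 0 := by linarith
      rw [gridPoint_pred h0 h1.le]
      field_simp
    · have h3 := one_add_le_gridPoint hh hN h0
      have h2 : gridPoint h N i ≠ 0 := by linarith
      have h4 : (gridPoint h N i - h) / gridPoint h N i ≤ 1 := by
        rw [div_le_one (by linarith)]; linarith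
      have h5 : 0 ≤ (gridPoint h N i - h) / gridPoint h N i :=
        div_nonneg (by linarith) (by linarith)
      have h6 := Real.sq_sqrt (by nlinarith : 0 ≤ 1 - ((gridPoint h N i - h) / gridPoint h N i) ^ 2)
      rw [gridPoint_pred hN.ne' le_rfl, ← gridPoint_of_le (not_lt.1 h1)]
      set R := √(1 - ((gridPoint h N i - h) / gridPoint h N i) ^ 2)
      rw [show (1 - R) * (1 - -R) = 1 - R ^ 2 by ring, h6]
      field_simp
      ring
  p_eq n i e := by
    have h0 : i = 0 := by
      by_contra h0
      have := one_add_le_gridPoint hh hN h0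
      nlinarith
    simp [h0]
  q_eq n i e := by
    have h0 : i = 0 := by
      by_contra h0
      have := one_add_le_gridPoint hh hN h0
      nlinarith
    simp [h0]

variable (hh : 0 < h) (hN : 0 < N)

lemma walkScheme_gain_zero (Φ : ℝ → ℝ) : (walkScheme h hh N hN).gain Φ 0 0 = 0 := by
  simp [Scheme.gain, walkScheme]

lemma sq_rpow_half {x : ℝ} (hx : 0 < x) (β : ℝ) : (x ^ 2) ^ ((β + 2) / 2) = x ^ β * x ^ 2 := by
  rw [← Real.rpow_natCast, ← Real.rpow_mul hx.le, ← Real.rpow_add hx]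
  congr 1; push_cast; ring

lemma walkScheme_gain_interior (β : ℝ) {i : ℕ} (h0 : i ≠ 0) (hi : i < N) :
    (walkScheme h hh N hN).gain (fun t => t ^ ((β + 2) / 2)) 0 i =
      8 * gridPoint h N i ^ β * h ^ 2 := by
  have h1 : 0 < gridPoint h N i := lt_of_lt_of_le one_pos (one_le_gridPoint hh i)
  simp only [Scheme.gain, walkScheme, if_neg h0, if_pos hi]
  rw [sq_rpow_half h1]
  field_simp
  ring

lemma walkScheme_gain_top (β : ℝ) {i : ℕ} (hi : N ≤ i) :
    (walkScheme h hh N hN).gain (fun t => t ^ ((β + 2) / 2)) 0 i =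
      8 * gridPoint h N N ^ β * (2 * gridPoint h N N * h - h ^ 2) := by
  have h0 : i ≠ 0 := by omega
  have h3 := one_add_le_gridPoint hh hN h0
  have h1 : 0 < gridPoint h N i := by linarith
  have h4 : (gridPoint h N i - h) / gridPoint h N i ≤ 1 := by
    rw [div_le_one (by linarith)]; linarith
  have h5 : 0 ≤ (gridPoint h N i - h) / gridPoint h N i :=
    div_nonneg (by linarith) (by linarith)
  have h6 := Real.sq_sqrt (by nlinarith : 0 ≤ 1 - ((gridPoint h N i - h) / gridPoint h N i) ^ 2)
  simp only [Scheme.gain, walkScheme, if_neg h0, if_neg (not_lt.2 hi)]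
  rw [sq_rpow_half h1, neg_sq, h6, ← gridPoint_of_le hi]
  field_simp
  ring

end Grid

/-- As x ≥ 1, the ratio u/x lies between 1 - h and 1/(1 - h). -/
lemma rpow_le_window {β x u h : ℝ} (hx : 1 ≤ x) (hh : 0 < h) (hh1 : h < 1)
    (hu : u ∈ Set.Icc (x - h) (x + h)) : u ^ β ≤ x ^ β * ((1 - h) ^ |β|)⁻¹ := by
  have hx0 : 0 < x := by linarith
  have h1 : 0 < 1 - h := by linarith
  have hz1 : 1 - h ≤ u / x := by rw [le_div_iff₀ hx0]; nlinarith [hu.1]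
  have hz2 : u / x ≤ (1 - h)⁻¹ := by
    rw [div_le_iff₀ hx0, inv_mul_eq_div, le_div_iff₀ h1]; nlinarith [hu.2]
  have hz0 : 0 < u / x := by linarith
  have e : u = x * (u / x) := by field_simp
  rw [e, Real.mul_rpow hx0.le hz0.le]
  refine mul_le_mul_of_nonneg_left ?_ (Real.rpow_nonneg hx0.le _)
  rcases le_total 0 β with hβ | hβ
  · rw [abs_of_nonneg hβ, ← Real.inv_rpow h1.le]
    exact Real.rpow_le_rpow hz0.le hz2 hβ
  · rw [abs_of_nonpos hβ, Real.rpow_neg h1.le, inv_inv]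
    exact Real.rpow_le_rpow_of_nonpos h1 hz1 hβ

namespace Profile

variable {β Y : ℝ} {F F' : ℝ → ℝ}

/-- (1-ε)F is a subsolution along the walk: ε absorbs the variation of u^β over one step (`h1`) and
the error in the reflection condition (`h2`). -/
lemma le_upperConst_of_step (hF : Profile β Y F F') (a : ℝ) {r : ℝ}
    (hr : 0 < r) {ε h : ℝ} {N : ℕ} (hε1 : ε ≤ 1) (hh : 0 < h) (hh1 : h < 1)
    (hN : 0 < N) (hY : Y = 1 + N * h) (h1 : 1 - ε ≤ (1 - h) ^ |β|)
    (h2 : (1 - ε) * F' (Y - h) ≤ 8 * Y ^ β * (2 * Y - h)) :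
    ENNReal.ofReal ((1 - ε) * F Y) ≤ upperConst a r (fun t => t ^ ((β + 2) / 2)) (Y ^ 2) := by
  have hYN : gridPoint h N N = Y := by rw [gridPoint, min_self, hY]
  set S := walkScheme h hh N hN with hS
  set Φ : ℝ → ℝ := fun t => t ^ ((β + 2) / 2) with hΦ
  have hx1 : ∀ i, 1 ≤ gridPoint h N i := one_le_gridPoint hh
  have hxY : ∀ i, gridPoint h N i ≤ Y := fun i => hYN ▸ gridPoint_le hh i
  have hτ : S.τ N = Y ^ 2 := by simp [hS, walkScheme, hYN]
  have hY1 : 1 + h ≤ Y := hYN ▸ one_add_le_gridPoint hh hN hN.ne'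
  have hgain : ∀ i, i ≠ 0 → 0 < S.gain Φ 0 i := by
    intro i h0
    have i1 := Real.rpow_pos_of_pos (lt_of_lt_of_le one_pos (hx1 i)) β
    rcases lt_or_ge i N with hi | hi
    · rw [walkScheme_gain_interior hh hN β h0 hi]; positivity
    · rw [walkScheme_gain_top hh hN β hi, hYN]
      have i2 := Real.rpow_pos_of_pos (by linarith : 0 < Y) β
      have : 0 < 2 * Y * h - h ^ 2 := by nlinarith
      positivity
  -- Only finitely many states are distinct; the gain is positive at each of them except 1, where F
  -- vanishes, so a small δ suits all.
  obtain ⟨δ, hδ0, hδ1, hδ⟩ : ∃ δ : ℝ, 0 < δ ∧ δ < 1 ∧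
      ∀ i, δ * ((1 - ε) * F (gridPoint h N i)) ≤ S.gain Φ 0 i := by
    have hev : ∀ᶠ δ : ℝ in nhdsWithin 0 (Set.Ioi 0), ∀ i ∈ Finset.Icc 1 N,
        δ * ((1 - ε) * F (gridPoint h N i)) < S.gain Φ 0 i := by
      rw [Filter.eventually_all_finset]
      intro i hi
      have ht : Filter.Tendsto (fun δ : ℝ => δ * ((1 - ε) * F (gridPoint h N i)))
          (nhdsWithin 0 (Set.Ioi 0)) (nhds 0) := by
        have : ContinuousAt (fun δ : ℝ => δ * ((1 - ε) * F (gridPoint h N i))) 0 := by fun_prop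
        simpa using this.tendsto.mono_left nhdsWithin_le_nhds
      exact ht.eventually_lt_const (hgain i (by rw [Finset.mem_Icc] at hi; omega))
    obtain ⟨δ, h3, h4⟩ := (hev.and (Ioo_mem_nhdsGT (one_pos (α := ℝ)))).exists
    refine ⟨δ, h4.1, h4.2, fun i => ?_⟩
    rcases Nat.eq_zero_or_pos i with rfl | hi0
    · rw [walkScheme_gain_zero]
      simp [gridPoint, hF.one]
    · rcases le_or_gt i N with hi | hi
      · exact (h3 i (Finset.mem_Icc.2 ⟨hi0, hi⟩)).le
      · have := h3 N (Finset.mem_Icc.2 ⟨hN, le_rfl⟩)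
        rw [walkScheme_gain_top hh hN β le_rfl] at this
        rw [walkScheme_gain_top hh hN β hi.le, gridPoint_of_le hi.le]
        exact this.le
  have key := S.le_upperConst_of_stationary (by simp [hS, walkScheme, gridPoint]) a hr (s := N)
    (Φ := Φ) (G := fun i => (1 - ε) * F (gridPoint h N i))
    (fun i => by
      simp only [hS, walkScheme]
      exact pow_le_pow_left₀ (by linarith [hx1 i]) (gridPoint_le hh i) 2)
    (fun t ht => Real.rpow_nonneg (by linarith) _) (fun i => ?_) hδ0 hδ1 hδ
  · simpa only [hτ, hYN] using key
  · rcases Nat.eq_zero_or_pos i with rfl | hi0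
    · simp [hS, walkScheme, Scheme.gain, gridPoint, hF.one]
    · have h0 : i ≠ 0 := hi0.ne'
      have hxi := one_add_le_gridPoint hh hN h0
      rcases lt_or_ge i N with hi | hi
      · have hu : S.up 0 i = i + 1 := by simp [hS, walkScheme, h0, hi]
        have hd : S.dn 0 i = i - 1 := by simp [hS, walkScheme, h0, hi]
        rw [walkScheme_gain_interior hh hN β h0 hi, hu, hd, gridPoint_succ hi,
          gridPoint_pred h0 hi.le]
        set x := gridPoint h N i
        have i1 := hF.second_diff_le hh.le (by linarith : h < x)
          (fun u hu => rpow_le_window (β := β) (hx1 i) hh hh1 hu)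
        have i2 := Real.rpow_pos_of_pos (by linarith : 0 < 1 - h) |β|
        have i3 := mul_le_mul_of_nonneg_left i1 (by linarith : 0 ≤ 1 - ε)
        have i4 : (1 - ε) * ((1 - h) ^ |β|)⁻¹ ≤ 1 := by
          rw [← div_eq_mul_inv, div_le_one i2]; exact h1
        have i5 := Real.rpow_pos_of_pos (by linarith : 0 < x) β
        have i6 := mul_le_mul_of_nonneg_left i4 (by positivity : 0 ≤ 16 * x ^ β * h ^ 2)
        linarith
      · have hu : S.up 0 i = N - 1 := by simp [hS, walkScheme, h0, not_lt.2 hi]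
        have hd : S.dn 0 i = N - 1 := by simp [hS, walkScheme, h0, not_lt.2 hi]
        rw [walkScheme_gain_top hh hN β hi, hu, hd, gridPoint_of_le hi,
          gridPoint_pred hN.ne' le_rfl, hYN]
        have i1 := hF.diff_le (by linarith : 0 < Y - h) (by linarith : Y - h ≤ Y)
        have i2 := mul_le_mul_of_nonneg_left i1 (by linarith : 0 ≤ 1 - ε)
        have i3 := mul_le_mul_of_nonneg_right h2 hh.le
        linarith

open Filter in
lemma le_upperConst (hF : Profile β Y F F') (a : ℝ) {r : ℝ} (hr : 0 < r) :
    ENNReal.ofReal (F Y) ≤ upperConst a r (fun t => t ^ ((β + 2) / 2)) (Y ^ 2) := by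
  rcases hF.one_le.eq_or_lt with hY | hY
  · rw [← hY, hF.one]; simp
  have hY0 : 0 < Y := by linarith
  have ht : Tendsto (fun ε : ℝ => ENNReal.ofReal ((1 - ε) * F Y)) (nhdsWithin 0 (Set.Ioi 0))
      (nhds (ENNReal.ofReal (F Y))) := by
    have : ContinuousAt (fun ε : ℝ => (1 - ε) * F Y) 0 := by fun_prop
    have h1 := this.tendsto
    simp only [sub_zero, one_mul] at h1
    exact (ENNReal.continuous_ofReal.tendsto _).comp (h1.mono_left nhdsWithin_le_nhds)
  refine le_of_tendsto ht ?_
  filter_upwards [Ioo_mem_nhdsGT (one_pos (α := ℝ))] with ε hε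
  have c1 : ContinuousAt (fun h : ℝ => (1 - h) ^ |β|) 0 :=
    (by fun_prop : ContinuousAt (fun h : ℝ => 1 - h) 0).rpow_const (Or.inl (by norm_num))
  have c2 : ContinuousAt (fun h : ℝ => (1 - ε) * F' (Y - h) - 8 * Y ^ β * (2 * Y - h)) 0 := by
    have : ContinuousAt (fun h : ℝ => F' (Y - h)) 0 := by
      refine ContinuousAt.comp (g := F') ?_ (by fun_prop)
      simpa using (hF.deriv' Y hY0).continuousAt
    exact (continuousAt_const.mul this).sub (by fun_prop)
  -- Both step conditions hold strictly in the limit h → 0, the second because F'(Y) = 16 Y^(β+1);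
  -- hence they hold for a fine grid dividing [1, Y].
  have e1 : ∀ᶠ h : ℝ in nhds 0, 1 - ε < (1 - h) ^ |β| :=
    c1.tendsto.eventually_const_lt (by simpa using hε.1)
  have e2 : ∀ᶠ h : ℝ in nhds 0, (1 - ε) * F' (Y - h) - 8 * Y ^ β * (2 * Y - h) < 0 := by
    refine c2.tendsto.eventually_lt_const ?_
    have := Real.rpow_pos_of_pos hY0 β
    rw [sub_zero, sub_zero, hF.top, Real.rpow_add_one hY0.ne']
    have : 0 < ε * (Y ^ β * Y) := by have := hε.1; positivity
    linarith
  have e3 : ∀ᶠ h : ℝ in nhds 0, h < 1 := gt_mem_nhds one_pos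
  have hseq : Tendsto (fun N : ℕ => (Y - 1) / ((N : ℝ) + 1)) atTop (nhds 0) := by
    simpa [div_eq_mul_inv] using
      (tendsto_one_div_add_atTop_nhds_zero_nat (𝕜 := ℝ)).const_mul (Y - 1)
  obtain ⟨N, ⟨h1, h2⟩, h3⟩ := (((hseq.eventually e1).and (hseq.eventually e2)).and
    (hseq.eventually e3)).exists
  refine hF.le_upperConst_of_step a hr (N := N + 1) hε.2.le
    (div_pos (by linarith) (by positivity)) h3 N.succ_pos ?_ h1.le (by linarith)
  push_cast
  field_simp
  ring

end Profile

/-! ### Explicit values of the constants. -/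

lemma rpow_nonneg_of_one_le (α : ℝ) : ∀ t : ℝ, 1 ≤ t → 0 ≤ (fun t : ℝ => t ^ α) t :=
  fun _ ht => Real.rpow_nonneg (by linarith) _

/-- The sharp value for positive exponents other than `1 / 2`. -/
def posValue (α Q : ℝ) : ℝ :=
  8 * (2 * α + 1) / α * Q ^ α - 32 * α / (2 * α - 1) * Q ^ (α - 1 / 2) + 8 / (α * (2 * α - 1))

/-- Integrates F'' = -16 y^(2α-2) twice. The first antiderivative is a logarithm when α = 1/2, which
is `profile_half`. -/
lemma profile_of_pos {α : ℝ} (hα : 0 < α) (hα2 : α ≠ 1 / 2) {Y : ℝ} (hY : 1 ≤ Y) :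
    Profile (2 * α - 2) Y
      (fun y => 16 / (2 * α - 1) * (2 * α * Y ^ (2 * α - 1) * (y - 1) - (y ^ (2 * α) - 1) / (2 * α)))
      (fun y => 16 / (2 * α - 1) * (2 * α * Y ^ (2 * α - 1) - y ^ (2 * α - 1))) := by
  have h1 : 2 * α - 1 ≠ 0 := fun h => hα2 (by linarith)
  refine ⟨hY, by simp, fun u hu => ?_, fun u hu => ?_, ?_⟩
  · refine (((((hasDerivAt_id u).sub_const 1).const_mul (2 * α * Y ^ (2 * α - 1))).sub
      (((Real.hasDerivAt_rpow_const (p := 2 * α) (Or.inl hu.ne')).sub_const 1).div_const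
        (2 * α))).const_mul (16 / (2 * α - 1))).congr_deriv ?_
    field_simp
  · refine (((Real.hasDerivAt_rpow_const (p := 2 * α - 1) (Or.inl hu.ne')).const_sub
      (2 * α * Y ^ (2 * α - 1))).const_mul (16 / (2 * α - 1))).congr_deriv ?_
    rw [show 2 * α - 1 - 1 = 2 * α - 2 by ring]
    field_simp
  · rw [show 2 * α - 2 + 1 = 2 * α - 1 by ring]
    field_simp

lemma profile_half {Y : ℝ} (hY : 1 ≤ Y) :
    Profile (-1) Y
      (fun y => 16 * (1 + Real.log Y) * (y - 1) - 16 * (y * Real.log y - y + 1))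
      (fun y => 16 * (1 + Real.log Y) - 16 * Real.log y) := by
  refine ⟨hY, by simp, fun u hu => ?_, fun u hu => ?_, ?_⟩
  · refine ((((hasDerivAt_id u).sub_const 1).const_mul (16 * (1 + Real.log Y))).sub
      (((((hasDerivAt_id u).mul (Real.hasDerivAt_log hu.ne')).sub
        (hasDerivAt_id u)).add_const 1).const_mul 16)).congr_deriv ?_
    simp only [id]
    field_simp
    ring
  · refine (((Real.hasDerivAt_log hu.ne').const_mul 16).const_sub
      (16 * (1 + Real.log Y))).congr_deriv ?_
    rw [Real.rpow_neg_one]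
    ring
  · norm_num
    ring

lemma sqrt_rpow {Q : ℝ} (hQ : 0 ≤ Q) (γ : ℝ) : √Q ^ γ = Q ^ (γ / 2) := by
  rw [Real.sqrt_eq_rpow, ← Real.rpow_mul hQ]; congr 1; ring

lemma profile_value {α Q : ℝ} (hα : 0 < α) (hα2 : α ≠ 1 / 2) (hQ : 1 ≤ Q) :
    16 / (2 * α - 1) * (2 * α * √Q ^ (2 * α - 1) * (√Q - 1) - (√Q ^ (2 * α) - 1) / (2 * α)) =
      posValue α Q := by
  have h1 : 2 * α - 1 ≠ 0 := fun h => hα2 (by linarith)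
  have hQ0 : 0 ≤ Q := by linarith
  have hs : 0 < √Q := Real.sqrt_pos.2 (by linarith)
  have e1 : √Q ^ (2 * α - 1) * √Q = Q ^ α := by
    rw [← Real.rpow_add_one hs.ne', sqrt_rpow hQ0]; congr 1; ring
  have e2 : √Q ^ (2 * α) = Q ^ α := by
    rw [sqrt_rpow hQ0]; congr 1; ring
  have e3 : √Q ^ (2 * α - 1) = Q ^ (α - 1 / 2) := by
    rw [sqrt_rpow hQ0]; congr 1; ring
  have e4 : 2 * α * √Q ^ (2 * α - 1) * (√Q - 1) = 2 * α * (Q ^ α - Q ^ (α - 1 / 2)) := by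
    rw [← e1, ← e3]; ring
  rw [e4, e2, posValue]
  field_simp
  ring

lemma posValue_nonneg {α Q : ℝ} (hα : 0 < α) (hα2 : α ≠ 1 / 2) (hQ : 1 ≤ Q) :
    0 ≤ posValue α Q := by
  have h := profile_of_pos hα hα2 (Real.one_le_sqrt.2 hQ)
  rw [← profile_value hα hα2 hQ]
  exact h.nonneg (by linarith) (Real.one_le_sqrt.2 hQ) le_rfl

lemma beta_cond {α : ℝ} (hα : (0 < α ∧ α ≤ 1) ∨ 3 / 2 ≤ α) :
    (-2 ≤ 2 * α - 2 ∧ 2 * α - 2 ≤ 0) ∨ 1 ≤ 2 * α - 2 := by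
  rcases hα with h | h
  · left; constructor <;> linarith [h.1, h.2]
  · right; linarith

theorem upperPow_of_pos (a : ℝ) {r α Q : ℝ} (hr : 0 < r)
    (hα : (0 < α ∧ α ≤ 1) ∨ 3 / 2 ≤ α) (hα2 : α ≠ 1 / 2) (hQ : 1 ≤ Q) :
    upperPow a r α Q = ENNReal.ofReal (posValue α Q) := by
  have hα0 : 0 < α := by rcases hα with h | h <;> [exact h.1; linarith]
  have h := profile_of_pos hα0 hα2 (Real.one_le_sqrt.2 hQ)
  have i1 := h.upperConst_le (beta_cond hα) a hr
  have i2 := h.le_upperConst a hr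
  have e : (2 * α - 2 + 2) / 2 = α := by ring
  rw [profile_value hα0 hα2 hQ, Real.sq_sqrt (by linarith), e] at i1 i2
  exact le_antisymm i1 i2

theorem upperPow_half (a : ℝ) {r Q : ℝ} (hr : 0 < r) (hQ : 1 ≤ Q) :
    0 ≤ 32 * Q ^ (1 / 2 : ℝ) - 8 * Real.log Q - 32 ∧
    upperPow a r (1 / 2) Q = ENNReal.ofReal (32 * Q ^ (1 / 2 : ℝ) - 8 * Real.log Q - 32) := by
  have hs := Real.one_le_sqrt.2 hQ
  have h := profile_half hs
  have i0 := h.nonneg (by norm_num) hs le_rfl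
  have i1 := h.upperConst_le (by norm_num) a hr
  have i2 := h.le_upperConst a hr
  have e : 16 * (1 + Real.log √Q) * (√Q - 1) - 16 * (√Q * Real.log √Q - √Q + 1) =
      32 * Q ^ (1 / 2 : ℝ) - 8 * Real.log Q - 32 := by
    rw [← Real.sqrt_eq_rpow, Real.log_sqrt (by linarith)]
    ring
  have e2 : (-1 + 2 : ℝ) / 2 = 1 / 2 := by norm_num
  rw [e] at i0
  rw [e, Real.sq_sqrt (by linarith), e2] at i1 i2
  exact ⟨i0, le_antisymm i1 i2⟩

theorem upperPow_zero (a : ℝ) {r Q : ℝ} (hr : 0 < r) (hQ : 1 ≤ Q) :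
    upperPow a r 0 Q = ENNReal.ofReal (8 * Real.log Q) := by
  refine le_antisymm ?_ (le_upperConst_of_tendsto a hr (rpow_nonneg_of_one_le 0) hQ
    (tendsto_productSum_zero hQ))
  refine upperConst_le a hr hQ (rpow_nonneg_of_one_le 0) (isSuper_log Q) (fun t ht => ?_)
    fun t ht => ?_
  · have := Real.log_nonneg ht.1; positivity
  · have := Real.log_le_log (by linarith [ht.1]) ht.2
    linarith

lemma div_mul_rpow_sub_one_mono {α s t : ℝ} (hα : α ≠ 0) (hs : 1 ≤ s) (hst : s ≤ t) :
    8 / α * (s ^ α - 1) ≤ 8 / α * (t ^ α - 1) := by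
  rcases lt_or_gt_of_ne hα with h | h
  · have := Real.rpow_le_rpow_of_nonpos (by linarith) hst h.le
    exact mul_le_mul_of_nonpos_left (by linarith)
      (div_nonpos_of_nonneg_of_nonpos (by norm_num) h.le)
  · have := Real.rpow_le_rpow (by linarith) hst h.le
    exact mul_le_mul_of_nonneg_left (by linarith) (by positivity)

lemma div_mul_rpow_sub_one_nonneg {α t : ℝ} (hα : α ≠ 0) (ht : 1 ≤ t) :
    0 ≤ 8 / α * (t ^ α - 1) := by
  have := div_mul_rpow_sub_one_mono hα le_rfl ht
  simpa using this

theorem upperPow_of_neg (a : ℝ) {r α Q : ℝ} (hr : 0 < r) (hα : α < 0) (hQ : 1 ≤ Q) :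
    upperPow a r α Q = ENNReal.ofReal (8 / α * (Q ^ α - 1)) :=
  le_antisymm (upperConst_le a hr hQ (rpow_nonneg_of_one_le α) (isSuper_rpow Q hα)
    (fun _ ht => div_mul_rpow_sub_one_nonneg hα.ne ht.1)
    fun _ ht => div_mul_rpow_sub_one_mono hα.ne ht.1 ht.2)
    (le_upperConst_of_tendsto a hr (rpow_nonneg_of_one_le α) hQ
      (tendsto_productSum_rpow hQ hα.ne))

theorem lowerPow_of_one_le (a : ℝ) {r α Q : ℝ} (hr : 0 < r) (hα : 1 ≤ α) (hQ : 1 ≤ Q) :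
    lowerPow a r α Q = ENNReal.ofReal (8 / α * (Q ^ α - 1)) := by
  have h0 : α ≠ 0 := by linarith
  refine le_antisymm (lowerConst_le_of_tendsto a hr (rpow_nonneg_of_one_le α) hQ
      (tendsto_productSum_rpow hQ h0)) ?_
  refine le_lowerConst a hr hQ (f := fun t => 8 / α * (t ^ α - 1)) (rpow_nonneg_of_one_le α)
    (isSub_rpow Q hα) (by simp) (fun t ht => ?_)
    fun s hs t _ hst => div_mul_rpow_sub_one_mono h0 hs.1 hst
  exact continuousAt_const.mul
    ((Real.continuousAt_rpow_const _ _ (Or.inl (by linarith))).sub continuousAt_const)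

theorem lowerPow_of_lt_one (a : ℝ) {r α Q : ℝ} (hr : 0 < r) (hα : α < 1) (hQ : 1 ≤ Q) :
    lowerPow a r α Q = ENNReal.ofReal (8 * (Q ^ α - Q ^ (α - 1))) := by
  have e : Q ^ (α - 1) * Q = Q ^ α := by
    rw [← Real.rpow_add_one (by linarith)]; congr 1; ring
  refine le_antisymm ?_ ?_
  -- A single split from Q to 1 is already extremal.
  · have h := lowerConst_le_productSum 1 hQ a hr (rpow_nonneg_of_one_le α)
    have e2 : productSum Q (fun t => t ^ α) 1 = 8 * (Q ^ α - Q ^ (α - 1)) := by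
      have : Q ≠ 0 := by linarith
      simp only [productSum, Finset.sum_range_one, zero_add, pow_one]
      rw [← e]
      field_simp
    rwa [e2, pow_one] at h
  · have h := le_lowerConst a hr hQ (f := fun t => 8 * Q ^ (α - 1) * (t - 1))
      (rpow_nonneg_of_one_le α) (isSub_linear hα.le) (by simp) (fun t _ => by fun_prop)
      fun s _ t _ hst => by
        have := Real.rpow_nonneg (by linarith : 0 ≤ Q) (α - 1)
        simp only
        gcongr
    have e2 : 8 * Q ^ (α - 1) * (Q - 1) = 8 * (Q ^ α - Q ^ (α - 1)) := by rw [← e]; ring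
    rwa [e2] at h

lemma lowerValue_nonneg {α Q : ℝ} (hQ : 1 ≤ Q) : 0 ≤ 8 * (Q ^ α - Q ^ (α - 1)) := by
  have := Real.rpow_le_rpow_of_exponent_le hQ (by linarith : α - 1 ≤ α)
  linarith

/-! ### Interpolation for 1 < α < 3/2. -/

lemma posValue_one {Q : ℝ} (hQ : 1 ≤ Q) : posValue 1 Q = 8 * (√Q - 1) * (3 * √Q - 1) := by
  have h := Real.sq_sqrt (by linarith : 0 ≤ Q)
  rw [posValue, show (1 : ℝ) - 1 / 2 = 1 / 2 by norm_num, ← Real.sqrt_eq_rpow, Real.rpow_one]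
  norm_num
  linear_combination (-24) * h

lemma posValue_three_halves {Q : ℝ} (hQ : 1 ≤ Q) :
    posValue (3 / 2) Q = 8 / 3 * (√Q - 1) * (8 * Q - √Q - 1) := by
  have h := Real.sq_sqrt (by linarith : 0 ≤ Q)
  have e : Q ^ (3 / 2 : ℝ) = Q * √Q := by
    rw [Real.sqrt_eq_rpow, mul_comm, ← Real.rpow_add_one (by linarith)]; norm_num
  rw [posValue, show (3 / 2 : ℝ) - 1 / 2 = 1 by norm_num, Real.rpow_one, e]
  norm_num
  linear_combination (8 / 3) * h

/-- Weighted arithmetic and geometric means of s and √t bound t^α by a combination of t and t^(3/2);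
the same combination of the two profiles is then a supersolution. -/
lemma upperPow_le_combo (a : ℝ) {r α Q s : ℝ} (hr : 0 < r) (hα : 1 < α) (hα' : α < 3 / 2)
    (hQ : 1 ≤ Q) (hs : 0 < s) :
    upperPow a r α Q ≤ ENNReal.ofReal ((3 - 2 * α) * s ^ (2 * α - 2) * posValue 1 Q +
      (2 * α - 2) * s ^ (2 * α - 3) * posValue (3 / 2) Q) := by
  have hQs := Real.one_le_sqrt.2 hQ
  have h1 := profile_of_pos (one_pos) (by norm_num) hQs
  have h2 := profile_of_pos (by norm_num : (0 : ℝ) < 3 / 2) (by norm_num) hQs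
  have s1 := h1.isSuper (beta_cond (by norm_num))
  have s2 := h2.isSuper (beta_cond (by norm_num))
  rw [Real.sq_sqrt (by linarith)] at s1 s2
  have hA : 0 ≤ (3 - 2 * α) * s ^ (2 * α - 2) :=
    mul_nonneg (by linarith) (Real.rpow_nonneg hs.le _)
  have hB : 0 ≤ (2 * α - 2) * s ^ (2 * α - 3) :=
    mul_nonneg (by linarith) (Real.rpow_nonneg hs.le _)
  have hsq : ∀ t ∈ Set.Icc 1 Q, 1 ≤ √t ∧ √t ≤ √Q := fun t ht =>
    ⟨Real.one_le_sqrt.2 ht.1, Real.sqrt_le_sqrt ht.2⟩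
  rw [← profile_value one_pos (by norm_num) hQ, ← profile_value (by norm_num) (by norm_num) hQ]
  refine upperConst_le a hr hQ (rpow_nonneg_of_one_le α) (s1.combo s2 hA hB fun t ht => ?_)
    (fun t ht => ?_) fun t ht => ?_
  · have ht0 : 0 < t := by linarith [ht.1]
    have hst := Real.sqrt_pos.2 ht0
    have am := Real.geom_mean_le_arith_mean2_weighted (by linarith : 0 ≤ 3 - 2 * α)
      (by linarith : 0 ≤ 2 * α - 2) hs.le hst.le (by ring)
    have hsp := Real.rpow_pos_of_pos hs (2 * α - 3)
    have e1 : s ^ (2 * α - 3) * s ^ (3 - 2 * α) = 1 := by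
      rw [← Real.rpow_add hs]; norm_num
    have e2 : s ^ (2 * α - 3) * s = s ^ (2 * α - 2) := by
      rw [← Real.rpow_add_one hs.ne']; congr 1; ring
    have e3 : t ^ α = t * √t ^ (2 * α - 2) := by
      rw [sqrt_rpow ht0.le, mul_comm, ← Real.rpow_add_one ht0.ne']; congr 1; ring
    have e4 : t ^ ((2 * (3 / 2) - 2 + 2) / 2 : ℝ) = t * √t := by
      rw [Real.sqrt_eq_rpow, mul_comm t, ← Real.rpow_add_one ht0.ne']; norm_num
    have e5 : t ^ ((2 * 1 - 2 + 2) / 2 : ℝ) = t := by norm_num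
    rw [e3, e4, e5, ← e2]
    have i := mul_le_mul_of_nonneg_left am (mul_pos ht0 hsp).le
    calc t * √t ^ (2 * α - 2)
        = t * (s ^ (2 * α - 3) * s ^ (3 - 2 * α)) * √t ^ (2 * α - 2) := by rw [e1, mul_one]
      _ ≤ _ := by linarith
  · exact add_nonneg (mul_nonneg hA (h1.nonneg (by norm_num) (hsq t ht).1 (hsq t ht).2))
      (mul_nonneg hB (h2.nonneg (by norm_num) (hsq t ht).1 (hsq t ht).2))
  · have hp : 0 < √t := by linarith [(hsq t ht).1]
    exact add_le_add
      (mul_le_mul_of_nonneg_left (h1.mono (by norm_num) hp (hsq t ht).2 le_rfl) hA)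
      (mul_le_mul_of_nonneg_left (h2.mono (by norm_num) hp (hsq t ht).2 le_rfl) hB)

lemma upperPow_le_geom_mean (a : ℝ) {r α Q : ℝ} (hr : 0 < r) (hα : 1 < α) (hα' : α < 3 / 2)
    (hQ : 1 ≤ Q) :
    upperPow a r α Q ≤ ENNReal.ofReal
      (posValue 1 Q ^ (3 - 2 * α) * posValue (3 / 2) Q ^ (2 * α - 2)) := by
  have hs := Real.sq_sqrt (by linarith : 0 ≤ Q)
  rcases hQ.eq_or_lt with rfl | hQ1
  -- At Q = 1 both endpoint values vanish and their ratio is unavailable; any s serves.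
  · have h := upperPow_le_combo a hr hα hα' le_rfl one_pos
    refine h.trans (ENNReal.ofReal_le_ofReal ?_)
    rw [posValue_one le_rfl, posValue_three_halves le_rfl]
    norm_num
    positivity
  have hs1 : 1 < √Q := by rw [Real.lt_sqrt zero_le_one]; simpa using hQ1
  have p1 : 0 < posValue 1 Q := by
    rw [posValue_one hQ]
    exact mul_pos (by linarith) (by linarith)
  have p2 : 0 < posValue (3 / 2) Q := by
    rw [posValue_three_halves hQ]
    exact mul_pos (by linarith) (by nlinarith)
  -- The ratio of the two endpoint values is the s that minimizes the bound.
  have h := upperPow_le_combo a hr hα hα' hQ (div_pos p2 p1)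
  refine h.trans (ENNReal.ofReal_le_ofReal (le_of_eq ?_))
  set x := posValue 1 Q
  set y := posValue (3 / 2) Q
  have e1 : (y / x) ^ (2 * α - 3) * y = (y / x) ^ (2 * α - 2) * x := by
    rw [show 2 * α - 2 = 2 * α - 3 + 1 by ring, Real.rpow_add_one (div_pos p2 p1).ne']
    field_simp
  have e2 : (y / x) ^ (2 * α - 2) * x = x ^ (3 - 2 * α) * y ^ (2 * α - 2) := by
    have e3 : x ^ (3 - 2 * α) * x ^ (2 * α - 2) = x := by
      rw [← Real.rpow_add p1]; norm_num
    have := (Real.rpow_pos_of_pos p1 (2 * α - 2)).ne'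
    rw [Real.div_rpow p2.le p1.le, div_mul_eq_mul_div, div_eq_iff this]
    linear_combination (-y ^ (2 * α - 2)) * e3
  rw [← e2]
  linear_combination (2 * α - 2) * e1

lemma geom_mean_eq {α Q : ℝ} (hQ : 1 ≤ Q) :
    posValue 1 Q ^ (3 - 2 * α) * posValue (3 / 2) Q ^ (2 * α - 2) =
      8 * 3 ^ (2 - 2 * α) * (√Q - 1) * (8 * Q - √Q - 1) ^ (2 * α - 2)
          * (3 * √Q - 1) ^ (3 - 2 * α) := by
  have hs := Real.sq_sqrt (by linarith : 0 ≤ Q)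
  have hs1 : 1 ≤ √Q := Real.one_le_sqrt.2 hQ
  have h0 : 0 ≤ √Q - 1 := by linarith
  have h1 : 0 ≤ 3 * √Q - 1 := by linarith
  have h2 : 0 ≤ 8 * Q - √Q - 1 := by nlinarith
  rw [posValue_one hQ, posValue_three_halves hQ, Real.mul_rpow (by positivity) h1,
    Real.mul_rpow (by positivity) h2, show 8 / 3 * (√Q - 1) = (8 * (√Q - 1)) * 3⁻¹ by ring,
    Real.mul_rpow (x := 8 * (√Q - 1)) (y := 3⁻¹) (by positivity) (by norm_num),
    Real.inv_rpow (by norm_num), ← Real.rpow_neg (by norm_num),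
    show -(2 * α - 2) = 2 - 2 * α by ring]
  have e : (8 * (√Q - 1)) ^ (3 - 2 * α) * (8 * (√Q - 1)) ^ (2 * α - 2) = 8 * (√Q - 1) := by
    rw [← Real.rpow_add' (by positivity) (by norm_num)]
    norm_num
  linear_combination (3 ^ (2 - 2 * α) * (8 * Q - √Q - 1) ^ (2 * α - 2)
    * (3 * √Q - 1) ^ (3 - 2 * α)) * e

/-- `ENNReal.ofReal` truncates at 0, so each closed formula has to be known nonnegative before it is
read in `EReal`. -/
lemma coe_ofReal {x : ℝ} (hx : 0 ≤ x) : ((ENNReal.ofReal x : ℝ≥0∞) : EReal) = (x : EReal) := by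
  rw [EReal.coe_ennreal_ofReal, max_eq_left hx]

end DyadicCarleson

end

theorem corollary2p4 (a r : ℝ) (hr : 0 < r) (α Q : ℝ) (hQ : 1 ≤ Q) :
    (α ∈ Set.Ioo (0 : ℝ) (1 / 2) ∪ Set.Ioc (1 / 2 : ℝ) 1 ∪ Set.Ici (3 / 2 : ℝ) →
      (DyadicCarleson.upperPow a r α Q : EReal) =
        ((8 * (2 * α + 1) / α * Q ^ α - 32 * α / (2 * α - 1) * Q ^ (α - 1 / 2)
          + 8 / (α * (2 * α - 1)) : ℝ) : EReal)) ∧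
    (α = 1 / 2 →
      (DyadicCarleson.upperPow a r α Q : EReal) =
        ((32 * Q ^ (1 / 2 : ℝ) - 8 * Real.log Q - 32 : ℝ) : EReal)) ∧
    (α = 0 →
      (DyadicCarleson.upperPow a r α Q : EReal) = ((8 * Real.log Q : ℝ) : EReal)) ∧
    (α < 0 →
      (DyadicCarleson.upperPow a r α Q : EReal) = ((8 / α * (Q ^ α - 1) : ℝ) : EReal)) ∧
    (α ∈ Set.Ioo (1 : ℝ) (3 / 2) →
      (DyadicCarleson.upperPow a r α Q : EReal) ≤
        ((8 * 3 ^ (2 - 2 * α) * (√Q - 1) * (8 * Q - √Q - 1) ^ (2 * α - 2)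
          * (3 * √Q - 1) ^ (3 - 2 * α) : ℝ) : EReal) ∧
      ((8 * 3 ^ (2 - 2 * α) * (√Q - 1) * (8 * Q - √Q - 1) ^ (2 * α - 2)
          * (3 * √Q - 1) ^ (3 - 2 * α) : ℝ) : EReal) =
        ((DyadicCarleson.upperPow a r 1 Q ^ (3 - 2 * α)
          * DyadicCarleson.upperPow a r (3 / 2) Q ^ (2 * α - 2) : ℝ≥0∞) : EReal)) ∧
    (1 ≤ α →
      (DyadicCarleson.lowerPow a r α Q : EReal) = ((8 / α * (Q ^ α - 1) : ℝ) : EReal)) ∧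
    (α < 1 →
      (DyadicCarleson.lowerPow a r α Q : EReal) =
        ((8 * (Q ^ α - Q ^ (α - 1)) : ℝ) : EReal)) := by

  open DyadicCarleson in
  refine ⟨fun h => ?_, fun h => ?_, fun h => ?_, fun h => ?_, fun h => ?_, fun h => ?_,
    fun h => ?_⟩
  · have h' : ((0 < α ∧ α ≤ 1) ∨ 3 / 2 ≤ α) ∧ α ≠ 1 / 2 := by
      rcases h with (h | h) | h
      · exact ⟨Or.inl ⟨h.1, by linarith [h.2]⟩, h.2.ne⟩
      · exact ⟨Or.inl ⟨by linarith [h.1], h.2⟩, h.1.ne'⟩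
      · have h : 3 / 2 ≤ α := h
        exact ⟨Or.inr h, by linarith⟩
    have hα0 : 0 < α := by rcases h'.1 with h | h <;> [exact h.1; linarith]
    rw [upperPow_of_pos a hr h'.1 h'.2 hQ, coe_ofReal (posValue_nonneg hα0 h'.2 hQ), posValue]
  · subst h
    obtain ⟨h0, h1⟩ := upperPow_half a hr hQ
    rw [h1, coe_ofReal h0]
  · subst h
    rw [upperPow_zero a hr hQ, coe_ofReal (mul_nonneg (by norm_num) (Real.log_nonneg hQ))]
  · rw [upperPow_of_neg a hr h hQ, coe_ofReal (div_mul_rpow_sub_one_nonneg h.ne hQ)]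
  · have n1 := posValue_nonneg one_pos (by norm_num) hQ
    have n2 := posValue_nonneg (by norm_num : (0 : ℝ) < 3 / 2) (by norm_num) hQ
    have n3 : 0 ≤ posValue 1 Q ^ (3 - 2 * α) * posValue (3 / 2) Q ^ (2 * α - 2) := by positivity
    rw [← geom_mean_eq hQ, ← coe_ofReal n3]
    refine ⟨EReal.coe_ennreal_le_coe_ennreal_iff.2 (upperPow_le_geom_mean a hr h.1 h.2 hQ), ?_⟩
    rw [upperPow_of_pos a hr (by norm_num) (by norm_num) hQ,
      upperPow_of_pos a hr (by norm_num) (by norm_num) hQ,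
      ENNReal.ofReal_rpow_of_nonneg n1 (by linarith [h.2]),
      ENNReal.ofReal_rpow_of_nonneg n2 (by linarith [h.1]), ENNReal.ofReal_mul (by positivity)]
  · rw [lowerPow_of_one_le a hr h hQ, coe_ofReal (div_mul_rpow_sub_one_nonneg (by linarith) hQ)]
  · rw [lowerPow_of_lt_one a hr h hQ, coe_ofReal (lowerValue_nonneg hQ)]
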